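/- Let $t$ be an indeterminate and let $A=\mathbb{Q}(t)[x_1,x_2,\dots,y_1,y_2,\dots]$. For a sequence $\mathbf a=(a_1,a_2,\dots)$ in a $\mathbb{Q}(t)$-algebra put $\xi_t(\mathbf a,z)=\sum_{n\ge1}(1-t^n)a_nz^n$, and define $q_n(\mathbf x),q_n(\mathbf y)\in A$ by $\sum_{n\ge0}q_n(\mathbf x)z^n=e^{\xi_t(\mathbf x,z)}$, $\sum_{n\ge0}q_n(\mathbf y)z^n=e^{\xi_t(\mathbf y,z)}$, with $q_n=0$ for $n<0$. For integer sequences $\alpha=(\alpha_1,\dots,\alpha_l)$ and $\beta=(\beta_1,\dots,\beta_{l'})$ put $q_{[\alpha,\beta]}=\prod_i q_{\alpha_i}(\mathbf x)\prod_a q_{\beta_a}(\mathbf y)$. For Young diagrams $\lambda=(\lambda_1,\dots,\lambda_l)$ and $\mu=(\mu_1,\dots,\mu_{l'})$ with $l$ and $l'$ rows, the coupled Hall--Littlewood function is $$Q_{[\lambda,\mu]}=\prod_{i<j}\frac{1-R_{\lambda_i\lambda_j}}{1-tR_{\lambda_i\lambda_j}}\prod_{a<b}\frac{1-R_{\mu_a\mu_b}}{1-tR_{\mu_a\mu_b}}\prod_{i,a}\frac{(1-D_{\lambda_i\mu_a})(1-t^2D_{\lambda_i\mu_a})}{(1-tD_{\lambda_i\mu_a})^2}\;q_{[\lambda,\mu]}\in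 A,$$ where the operators act on the pair of index sequences: $R_{\lambda_i\lambda_j}$ adds $1$ to the $i$-th entry and subtracts $1$ from the $j$-th entry of the first sequence, $R_{\mu_a\mu_b}$ does the same in the second sequence, and $D_{\lambda_i\mu_a}$ subtracts $1$ from the $i$-th entry of the first and from the $a$-th entry of the second sequence. All factors are expanded in nonnegative powers of the operators, their product is expanded, and each resulting monomial in the operators is applied to the index pair $(\lambda,\mu)$ before $q_{[\cdot,\cdot]}$ is evaluated; only finitely many terms are nonzero. Let $\Gamma_1^-(z)=\exp\xi_t(\mathbf x-\tilde\partial_{\mathbf y},z)$ and $\Gamma_2^-(z)=\exp\xi_t(\mathbf y-\tilde\partial_{\mathbf x},z)$, where $\mathbf x-\tilde\partial_{\mathbf y}=(x_n-\tfrac1n\partial_{y_n})_{n\ge1}$ and $\mathbf y-\tilde\partial_{\mathbf x}=(y_n-\tfrac1n\partial_{x_n})_{n\ge1}$ are sequences of operators on $A$; thus $\Gamma_1^-(z)$ and $\Gamma_2^-(z)$ are power series in $z$ with coefficients in $\mathrm{End}_{\mathbb{Q}(t)}(A)$ and map $A$ to $A[[z]]$. Write $\nu\succ\lambda$ if $\nu_1\ge\lambda_1\ge\nu_2\ge\lambda_2\ge\cdots$.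 In that case, with $\theta'_j$ the number of boxes of $\nu-\lambda$ in column $j$ and $m_j(\lambda)$ the number of parts of $\lambda$ equal to $j$, let $$P_{\nu/\lambda}(z,t)=\psi_{\nu/\lambda}(t)\,z^{|\nu|-|\lambda|},\qquad \psi_{\nu/\lambda}(t)=\prod_{j\ge1,\ \theta'_j<\theta'_{j+1}}\bigl(1-t^{m_j(\lambda)}\bigr).$$ Then for all Young diagrams $\lambda,\mu$, $$\Gamma_1^-(z)\,Q_{[\lambda,\mu]}=\sum_{\nu\succ\lambda}P_{\nu/\lambda}(z,t)\,Q_{[\nu,\mu]},\qquad \Gamma_2^-(z)\,Q_{[\lambda,\mu]}=\sum_{\nu\succ\mu}P_{\nu/\mu}(z,t)\,Q_{[\lambda,\nu]}$$ in $A[[z]]$, the sums being over all Young diagrams $\nu$ with the stated interlacing property; for each $n$ only finitely many $\nu$ contribute to the coefficient of $z^n$. -/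

import Mathlib

open scoped PowerSeries

noncomputable section

namespace CoupledHL

/-- The field of scalars `ℚ(t)`. -/
abbrev K : Type := RatFunc ℚ

/-- The indeterminate `t` of `ℚ(t)`. -/
def t : K := RatFunc.X

/-- The polynomial ring `ℚ(t)[x₁, x₂, …, y₁, y₂, …]`. -/
abbrev A : Type := MvPolynomial (ℕ+ ⊕ ℕ+) K

/-- The variable `xₙ`. -/
def x (n : ℕ+) : A := MvPolynomial.X (Sum.inl n)

/-- The variable `yₙ`. -/
def y (n : ℕ+) : A := MvPolynomial.X (Sum.inr n)

section Series

variable {R : Type*} [Ring R] [Algebra K R]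

/-- The series `ξ_t(a, z) = ∑_{n ≥ 1} (1 - tⁿ) aₙ zⁿ` in `R⟦z⟧`, for a sequence `a₁, a₂, …` in a
`ℚ(t)`-algebra `R`, commutative or not. -/
def xi (a : ℕ+ → R) : R⟦X⟧ :=
  PowerSeries.mk fun n => if h : 0 < n then (1 - t ^ n) • a ⟨n, h⟩ else 0

/-- The exponential `∑ₖ fᵏ / k!` of a power series `f` with zero constant term. As `fᵏ` is divisible
by `zᵏ`, only the terms with `k ≤ n` contribute to the coefficient of `zⁿ`. -/
def expSeries (f : R⟦X⟧) : R⟦X⟧ :=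
  PowerSeries.mk fun n =>
    ∑ k ∈ Finset.range (n + 1), ((k.factorial : K)⁻¹) • PowerSeries.coeff n (f ^ k)

/-- `qₙ(a)`, the coefficient of `zⁿ` in `exp ξ_t(a, z)`, and `0` for `n < 0`. -/
def q (a : ℕ+ → R) (n : ℤ) : R :=
  if n < 0 then 0 else PowerSeries.coeff n.toNat (expSeries (xi a))

end Series

/-- `q_{[α,β]}(x, y) = ∏ᵢ q_{αᵢ}(x) ∏ₐ q_{βₐ}(y)` for integer sequences `α`, `β`. -/
def qPair {l l' : ℕ} (α : Fin l → ℤ) (β : Fin l' → ℤ) : A :=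
  (∏ i, q x (α i)) * ∏ a, q y (β a)

/-- The coefficient of `Rᵏ` in the expansion of `(1 - R) / (1 - t R)`. -/
def raiseCoeff (k : ℕ) : K :=
  PowerSeries.coeff k ((1 - PowerSeries.X) * (1 - PowerSeries.C t * PowerSeries.X)⁻¹ : K⟦X⟧)

/-- The coefficient of `Dᵏ` in the expansion of
`(1 - D) / (1 - t D) * (1 - t² D) / (1 - t D)`. -/
def lowerCoeff (k : ℕ) : K :=
  PowerSeries.coeff k
    ((1 - PowerSeries.X) * (1 - PowerSeries.C t * PowerSeries.X)⁻¹ *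
      ((1 - PowerSeries.C (t ^ 2) * PowerSeries.X) *
        (1 - PowerSeries.C t * PowerSeries.X)⁻¹) : K⟦X⟧)

/-- The pairs `i < j` of indices. -/
abbrev Pairs (l : ℕ) : Type := {p : Fin l × Fin l // p.1 < p.2}

/-- The rows `(λ₁, …, λ_l)` of a Young diagram, where `l` is its number of rows. -/
def rows (lam : YoungDiagram) : Fin (lam.colLen 0) → ℤ := fun i => (lam.rowLen i : ℤ)

/-- The effect of `∏_{i<j} R_{ij}^{k_{ij}}` on an index sequence: `R_{ij}` adds `1` to the `i`-th
entry and subtracts `1` from the `j`-th. -/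
def raise {l : ℕ} (k : Pairs l → ℕ) (α : Fin l → ℤ) : Fin l → ℤ :=
  α + ∑ p, (k p : ℤ) • (Pi.single p.1.1 1 - Pi.single p.1.2 1 : Fin l → ℤ)

/-- The effect of `∏_{i,a} D_{ia}^{d_{ia}}` on the first index sequence. -/
def lowerLeft {l l' : ℕ} (d : Fin l × Fin l' → ℕ) (α : Fin l → ℤ) : Fin l → ℤ :=
  α - ∑ p, (d p : ℤ) • (Pi.single p.1 1 : Fin l → ℤ)

/-- The effect of `∏_{i,a} D_{ia}^{d_{ia}}` on the second index sequence. -/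
def lowerRight {l l' : ℕ} (d : Fin l × Fin l' → ℕ) (β : Fin l' → ℤ) : Fin l' → ℤ :=
  β - ∑ p, (d p : ℤ) • (Pi.single p.2 1 : Fin l' → ℤ)

/-- The term of the expanded raising operator formula with exponents `k` of the `R_{λᵢλⱼ}`, `m` of
the `R_{μₐμ_b}` and `d` of the `D_{λᵢμₐ}`. -/
def term {l l' : ℕ} (α : Fin l → ℤ) (β : Fin l' → ℤ)
    (e : (Pairs l → ℕ) × (Pairs l' → ℕ) × (Fin l × Fin l' → ℕ)) : A :=
  ((∏ p, raiseCoeff (e.1 p)) * (∏ p, raiseCoeff (e.2.1 p)) * ∏ p, lowerCoeff (e.2.2 p)) •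
    qPair (lowerLeft e.2.2 (raise e.1 α)) (lowerRight e.2.2 (raise e.2.1 β))

theorem weight_bound {l l' : ℕ} (α : Fin l → ℤ) (k : Pairs l → ℕ) (d : Fin l × Fin l' → ℕ)
    (h : ∀ i, 0 ≤ lowerLeft d (raise k α) i) :
    (∑ p, (k p : ℤ)) + ∑ p, (d p : ℤ) ≤ ∑ i : Fin l, (((i : ℕ) : ℤ) + 1) * α i := by
  let W : (Fin l → ℤ) →ₗ[ℤ] ℤ := ∑ i : Fin l, (((i : ℕ) : ℤ) + 1) • LinearMap.proj i
  have hW : ∀ v, W v = ∑ i : Fin l, (((i : ℕ) : ℤ) + 1) * v i := by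
    intro v
    simp [W]
  have hs : ∀ i : Fin l, W (Pi.single i 1) = ((i : ℕ) : ℤ) + 1 := by
    intro i
    rw [hW, Finset.sum_eq_single i] <;> simp +contextual
  have h0 : 0 ≤ W (lowerLeft d (raise k α)) := by
    rw [hW]
    exact Finset.sum_nonneg fun i _ => mul_nonneg (by positivity) (h i)
  simp only [lowerLeft, raise, map_sub, map_add, map_sum, map_smul, hs, smul_eq_mul] at h0
  have h2 : ∑ p : Pairs l, (k p : ℤ) * ((((p.1.1 : ℕ) : ℤ) + 1) - (((p.1.2 : ℕ) : ℤ) + 1)) ≤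
      ∑ p : Pairs l, -(k p : ℤ) := by
    refine Finset.sum_le_sum fun p _ => ?_
    have h3 : (p.1.1 : ℕ) < (p.1.2 : ℕ) := p.2
    have h5 : (((p.1.1 : ℕ) : ℤ) + 1) - (((p.1.2 : ℕ) : ℤ) + 1) ≤ -1 := by omega
    nlinarith [Int.natCast_nonneg (k p)]
  have h4 : ∑ p : Fin l × Fin l', (d p : ℤ) ≤
      ∑ p : Fin l × Fin l', (d p : ℤ) * (((p.1 : ℕ) : ℤ) + 1) := by
    refine Finset.sum_le_sum fun p _ => ?_
    nlinarith [Int.natCast_nonneg (d p), Int.natCast_nonneg (p.1 : ℕ),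
      mul_nonneg (Int.natCast_nonneg (d p)) (Int.natCast_nonneg (p.1 : ℕ))]
  rw [Finset.sum_neg_distrib] at h2
  rw [← hW]
  linarith

theorem q_of_neg {R : Type*} [Ring R] [Algebra K R] (a : ℕ+ → R) {n : ℤ} (hn : n < 0) :
    q a n = 0 := by
  simp [q, hn]

theorem term_support_finite {l l' : ℕ} (α : Fin l → ℤ) (β : Fin l' → ℤ) :
    (Function.support (term α β)).Finite := by
  classical
  let N : ℕ := (∑ i : Fin l, (((i : ℕ) : ℤ) + 1) * α i).toNat
  let M : ℕ := (∑ i : Fin l', (((i : ℕ) : ℤ) + 1) * β i).toNat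
  refine (Set.finite_Icc 0 ((fun _ => N, fun _ => M, fun _ => N) :
    (Pairs l → ℕ) × (Pairs l' → ℕ) × (Fin l × Fin l' → ℕ))).subset ?_
  rintro ⟨k, m, d⟩ he
  have hq : qPair (lowerLeft d (raise k α)) (lowerRight d (raise m β)) ≠ 0 := by
    intro h
    exact he (by simp [term, h])
  have hα : ∀ i, 0 ≤ lowerLeft d (raise k α) i := by
    intro i
    by_contra! hi
    exact hq (by rw [qPair, Finset.prod_eq_zero (Finset.mem_univ i) (q_of_neg x hi), zero_mul])
  have hβ : ∀ i, 0 ≤ lowerRight d (raise m β) i := by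
    intro i
    by_contra! hi
    exact hq (by rw [qPair, Finset.prod_eq_zero (Finset.mem_univ i) (q_of_neg y hi), mul_zero])
  have hβ' : ∀ i, 0 ≤ lowerLeft (d ∘ Prod.swap) (raise m β) i := by
    intro i
    have h := hβ i
    have hsum : ∑ p : Fin l' × Fin l, ((d ∘ Prod.swap) p : ℤ) • (Pi.single p.1 1 : Fin l' → ℤ) =
        ∑ p : Fin l × Fin l', (d p : ℤ) • (Pi.single p.2 1 : Fin l' → ℤ) :=
      Fintype.sum_equiv (Equiv.prodComm _ _) _ _ (fun p => rfl)
    rw [lowerLeft, hsum]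
    exact h
  have h1 := weight_bound α k d hα
  have h2 := weight_bound β m (d ∘ Prod.swap) hβ'
  have hd' : (0 : ℤ) ≤ ∑ p, ((d ∘ Prod.swap) p : ℤ) := Finset.sum_nonneg fun p _ => by positivity
  have hd : (0 : ℤ) ≤ ∑ p, (d p : ℤ) := Finset.sum_nonneg fun p _ => by positivity
  have hk : (0 : ℤ) ≤ ∑ p, (k p : ℤ) := Finset.sum_nonneg fun p _ => by positivity
  have h0 : (0 : (Pairs l → ℕ) × (Pairs l' → ℕ) × (Fin l × Fin l' → ℕ)) ≤ (k, m, d) :=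
    ⟨fun _ => Nat.zero_le _, fun _ => Nat.zero_le _, fun _ => Nat.zero_le _⟩
  refine Set.mem_Icc.2
    ⟨h0, Prod.mk_le_mk.2 ⟨fun p => ?_, Prod.mk_le_mk.2 ⟨fun p => ?_, fun p => ?_⟩⟩⟩
  · have := Finset.single_le_sum (f := fun p => (k p : ℤ)) (fun p _ => by positivity)
      (Finset.mem_univ p)
    show k p ≤ N
    omega
  · have := Finset.single_le_sum (f := fun p => (m p : ℤ)) (fun p _ => by positivity)
      (Finset.mem_univ p)
    show m p ≤ M
    omega
  · have := Finset.single_le_sum (f := fun p => (d p : ℤ)) (fun p _ => by positivity)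
      (Finset.mem_univ p)
    show d p ≤ N
    omega

/-- The coupled Hall-Littlewood function
`Q_{[λ,μ]} = ∏_{i<j} (1-R_{λᵢλⱼ})/(1-tR_{λᵢλⱼ}) ∏_{a<b} (1-R_{μₐμ_b})/(1-tR_{μₐμ_b})
  ∏_{i,a} (1-D_{λᵢμₐ})(1-t²D_{λᵢμₐ})/(1-tD_{λᵢμₐ})² q_{[λ,μ]}`,
every factor being expanded in nonnegative powers of its operator. Only finitely many terms are
nonzero, see `term_support_finite`. -/
def Q (lam mu : YoungDiagram) : A :=
  ∑ᶠ e, term (rows lam) (rows mu) e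

/-- The operator `xₙ - (1/n) ∂/∂yₙ` on `ℚ(t)[x, y]`. -/
def xOp (n : ℕ+) : Module.End K A :=
  LinearMap.mulLeft K (x n) - ((n : ℕ) : K)⁻¹ • (MvPolynomial.pderiv (Sum.inr n)).toLinearMap

/-- The operator `yₙ - (1/n) ∂/∂xₙ` on `ℚ(t)[x, y]`. -/
def yOp (n : ℕ+) : Module.End K A :=
  LinearMap.mulLeft K (y n) - ((n : ℕ) : K)⁻¹ • (MvPolynomial.pderiv (Sum.inl n)).toLinearMap

/-- The vertex operator `Γ₁⁻(z) = exp ξ_t(x - ∂̃_y, z)`, a power series in `z` whose coefficients are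
operators on `ℚ(t)[x, y]`. -/
def Gamma1 : (Module.End K A)⟦X⟧ := expSeries (xi xOp)

/-- The vertex operator `Γ₂⁻(z) = exp ξ_t(y - ∂̃_x, z)`. -/
def Gamma2 : (Module.End K A)⟦X⟧ := expSeries (xi yOp)

/-- Action of a power series of operators on a polynomial, coefficient by coefficient. -/
def act (G : (Module.End K A)⟦X⟧) (f : A) : A⟦X⟧ :=
  PowerSeries.mk fun n => (PowerSeries.coeff n G) f

/-- Interlacing `ν ≻ λ`, that is `ν₁ ≥ λ₁ ≥ ν₂ ≥ λ₂ ≥ ⋯`. -/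
def Interlaces (nu lam : YoungDiagram) : Prop :=
  ∀ i, lam.rowLen i ≤ nu.rowLen i ∧ nu.rowLen (i + 1) ≤ lam.rowLen i

/-- `θ'ⱼ`, the number of boxes of `ν - λ` in the `j`-th column, for `j ≥ 1`. -/
def skewCol (nu lam : YoungDiagram) (j : ℕ) : ℤ :=
  (nu.colLen (j - 1) : ℤ) - (lam.colLen (j - 1) : ℤ)

/-- The set `J_{ν/λ}` of the `j ≥ 1` with `θ'ⱼ < θ'ⱼ₊₁`; such a `j` is less than `ν₁`
when `λ ⊆ ν`. -/
def J (nu lam : YoungDiagram) : Finset ℕ :=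
  {j ∈ Finset.Icc 1 (nu.rowLen 0) | skewCol nu lam j < skewCol nu lam (j + 1)}

/-- `ψ_{ν/λ}(t) = ∏_{j ∈ J_{ν/λ}} (1 - t^{m_j(λ)})`, where `m_j(λ)` is the number of parts of `λ`
equal to `j`. -/
def psi (nu lam : YoungDiagram) : K :=
  ∏ j ∈ J nu lam, (1 - t ^ (lam.rowLens.count j))

open Classical in
/-- The one-variable skew Hall-Littlewood function `P_{ν/λ}(z, t)`, as a polynomial in `z`. -/
def P (nu lam : YoungDiagram) : Polynomial K :=
  if Interlaces nu lam then Polynomial.monomial (nu.card - lam.card) (psi nu lam) else 0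

/-- The product of a polynomial in `z` over `ℚ(t)` and an element of `ℚ(t)[x, y]`, in
`ℚ(t)[x, y]⟦z⟧`. -/
def scale (p : Polynomial K) (f : A) : A⟦X⟧ :=
  ((p.map (algebraMap K A) : Polynomial A) : A⟦X⟧) * PowerSeries.C f

/-- `g` is the sum of the family `f` of formal power series: for each `n` only finitely many members
contribute to the coefficient of `zⁿ`, and their contributions add up to the one of `g`. -/
def IsFormalSum {ι : Type*} (f : ι → A⟦X⟧) (g : A⟦X⟧) : Prop :=
  ∀ n, (Function.support fun i => PowerSeries.coeff n (f i)).Finite ∧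
    PowerSeries.coeff n g = ∑ᶠ i, PowerSeries.coeff n (f i)

end CoupledHL

end

/-! Write `H_m` for `q xOp m`, the coefficient of `z^m` in `Γ₁⁻(z)`. The derivations in `y` commute
with multiplication by the `xₙ`, so `Γ₁⁻` is a translation of the `yₙ` by `-(1 - tⁿ)zⁿ/n` followed
by multiplication by `exp ξ_t(x, z)`. Composing it with the translation of the `xₙ` by `-uⁿ/n`,
where `u = z⁻¹`, gives the operators `B_n` (`vertexOp`). On products of the `q`'s these translations
produce the factors `(1 - R)/(1 - tR)` and `(1 - D)(1 - t²D)/(1 - tD)²`, which are exponentials of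
the corresponding weights. Hence `B_n` prepends a part `n` to the first sequence (`coupledQ_cons`),
and `Q_{[λ,μ]} = B_{λ₁} ⋯ B_{λ_l} Q_{[∅,μ]}`. On `Q_{[∅,μ]}`, which is free of the `xₙ`, `B_n` acts
as `H_n`.

Two relations suffice: `B_n H_m - t B_{n+1} H_{m-1} = H_m B_n - H_{m-1} B_{n+1}` (`vertexOp_q_xOp`)
and the straightening rule for `B_n B_r` (`vertexOp_vertexOp`). Pieri's formula `q_xOp_listQ`
follows by induction on the number of parts and on `m`: the first relation trades `H_m B_n` for
`H_{m-1} B_{n+1}` and terms with `H` moved past `B`, and the straightening rule matches the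
coefficients (`sum_strip_identity`). The recursive coefficients are then identified with `ψ_{ν/λ}`,
using that `θ'_j < θ'_{j+1}` means `m_j(ν) < m_j(λ)`. The formula for `Γ₂⁻` follows by exchanging
`x` and `y`. -/

open scoped PowerSeries

noncomputable section

namespace CoupledHL

/-! ### Functoriality of `q` and reduction to commutative algebras -/

section Functoriality

open PowerSeries

universe u

variable {R : Type u} {S : Type*} [Ring R] [Algebra K R] [Ring S] [Algebra K S]

theorem map_xi (φ : R →ₐ[K] S) (a : ℕ+ → R) :
    PowerSeries.map (φ : R →+* S) (xi a) = xi fun n => φ (a n) := by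
  ext n
  simp only [xi, coeff_map, coeff_mk]
  split_ifs <;> simp

theorem map_expSeries (φ : R →ₐ[K] S) (f : R⟦X⟧) :
    PowerSeries.map (φ : R →+* S) (expSeries f) =
      expSeries (PowerSeries.map (φ : R →+* S) f) := by
  ext n
  simp [expSeries, ← map_pow]

theorem map_q (φ : R →ₐ[K] S) (a : ℕ+ → R) (n : ℤ) :
    φ (q a n) = q (fun k => φ (a k)) n := by
  unfold q
  split_ifs
  · simp
  · rw [← map_xi, ← map_expSeries, coeff_map]
    rfl

theorem q_natCast (a : ℕ+ → R) (n : ℕ) : q a (n : ℤ) = coeff n (expSeries (xi a)) := by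
  simp [q]

theorem constantCoeff_xi (a : ℕ+ → R) : constantCoeff (xi a) = 0 := by
  simp [xi]

theorem coeff_expSeries_zero (f : R⟦X⟧) : coeff 0 (expSeries f) = 1 := by
  simp [expSeries]

theorem q_zero (a : ℕ+ → R) : q a 0 = 1 := by
  have := q_natCast a 0
  rw [coeff_expSeries_zero] at this
  exact_mod_cast this

theorem xi_add (a b : ℕ+ → R) : xi (fun n => a n + b n) = xi a + xi b := by
  ext n
  simp only [xi, coeff_mk, map_add]
  split_ifs <;> simp

/-- A commuting family generates a commutative subalgebra. Together with `map_q` this lets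
exponential identities for commuting operators be proved over commutative rings. -/
theorem exists_commRing_lift {ι : Type*} (a : ι → R) (h : ∀ i j, Commute (a i) (a j)) :
    ∃ (C : Type u) (_ : CommRing C) (_ : Algebra K C) (φ : C →ₐ[K] R) (a' : ι → C),
      ∀ i, φ (a' i) = a i := by
  let s : Set R := Set.range a
  have hs : ∀ u ∈ s, ∀ v ∈ s, u * v = v * u := by
    rintro _ ⟨i, rfl⟩ _ ⟨j, rfl⟩
    exact h i j
  have := Algebra.isMulCommutative_adjoin K hs
  let _ : CommRing (Algebra.adjoin K s) :=
    { (inferInstance : Ring (Algebra.adjoin K s)) with mul_comm := fun u v => mul_comm' u v }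
  exact ⟨Algebra.adjoin K s, inferInstance, (Algebra.adjoin K s).algebra,
    (Algebra.adjoin K s).val, fun i => ⟨a i, Algebra.subset_adjoin ⟨i, rfl⟩⟩, fun i => rfl⟩

end Functoriality

/-! ### Exponentials of power series and their differential equation -/

section Exponential

open PowerSeries

variable {R : Type*} [CommRing R] [Algebra K R]

theorem coeff_pow_eq_zero {R : Type*} [CommRing R] {f : R⟦X⟧} (hf : constantCoeff f = 0)
    {n k : ℕ} (h : n < k) :
    coeff n (f ^ k) = 0 :=
  X_pow_dvd_iff.1 (pow_dvd_pow_of_dvd (X_dvd_iff.2 hf) k) n h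

theorem coeff_expSeries {f : R⟦X⟧} (hf : constantCoeff f = 0) {n N : ℕ} (h : n < N) :
    coeff n (expSeries f) =
      ∑ k ∈ Finset.range N, ((k.factorial : K)⁻¹) • coeff n (f ^ k) := by
  rw [expSeries, coeff_mk]
  refine Finset.sum_subset (Finset.range_mono h) fun k _ hk => ?_
  rw [coeff_pow_eq_zero hf (by simpa using hk), smul_zero]

theorem derivative_expSeries {f : R⟦X⟧} (hf : constantCoeff f = 0) :
    derivative R (expSeries f) = derivative R f * expSeries f := by
  ext n
  have h1 : coeff n (derivative R f * expSeries f) =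
      ∑ k ∈ Finset.range (n + 1), ((k.factorial : K)⁻¹) • coeff n (derivative R f * f ^ k) := by
    simp only [coeff_mul, Finset.smul_sum]
    rw [Finset.sum_comm]
    refine Finset.sum_congr rfl fun p hp => ?_
    have : p.2 ≤ n := by have := Finset.HasAntidiagonal.mem_antidiagonal.1 hp; omega
    rw [coeff_expSeries hf (N := n + 1) (by omega), Finset.mul_sum]
    simp
  rw [h1, coeff_derivative, coeff_expSeries hf (N := n + 2) (by omega),
    Finset.sum_range_succ', add_mul, Finset.sum_mul]
  have h0 : ((Nat.factorial 0 : K)⁻¹ • coeff (n + 1) (f ^ 0)) * ((n : R) + 1) = 0 := by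
    simp [coeff_one]
  rw [h0, add_zero]
  refine Finset.sum_congr rfl fun k _ => ?_
  have h2 : coeff (n + 1) (f ^ (k + 1)) * ((n : R) + 1) =
      ((k : K) + 1) • coeff n (derivative R f * f ^ k) := by
    rw [← coeff_derivative, derivative_pow, Algebra.smul_def, map_add, map_natCast, map_one]
    have : ((k + 1 : ℕ) : R⟦X⟧) * f ^ (k + 1 - 1) * derivative R f =
        C ((k : R) + 1) * (derivative R f * f ^ k) := by
      simp only [Nat.add_sub_cancel, map_add, map_one, map_natCast]
      push_cast
      ring
    rw [this, coeff_C_mul]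
  rw [smul_mul_assoc, h2, smul_smul]
  congr 1
  rw [Nat.factorial_succ]
  have : (k : K) + 1 ≠ 0 := by exact_mod_cast Nat.succ_ne_zero k
  push_cast
  rw [mul_inv, mul_assoc, mul_comm, mul_assoc, mul_inv_cancel₀ this, mul_one]

/-- The equation `f' = hf` expresses `(n + 1)fₙ₊₁` through earlier coefficients, and `n + 1` is
invertible because `R` is an algebra over a field of characteristic zero. -/
theorem eq_of_derivative_eq_mul {f g h : R⟦X⟧} (h0 : coeff 0 f = coeff 0 g)
    (hf : derivative R f = h * f) (hg : derivative R g = h * g) : f = g := by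
  ext n
  induction n using Nat.strong_induction_on with
  | _ n ih =>
    rcases n with _ | n
    · exact h0
    · have e : coeff (n + 1) f * ((n : R) + 1) = coeff (n + 1) g * ((n : R) + 1) := by
        rw [← coeff_derivative, ← coeff_derivative, hf, hg, coeff_mul, coeff_mul]
        refine Finset.sum_congr rfl fun p hp => ?_
        rw [ih p.2 (by have := Finset.HasAntidiagonal.mem_antidiagonal.1 hp; omega)]
      have hu : IsUnit ((n : R) + 1) := by
        have h1 : ((n : K) + 1) ≠ 0 := by exact_mod_cast Nat.succ_ne_zero n
        have := (IsUnit.mk0 _ h1).map (algebraMap K R)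
        simpa using this
      exact hu.mul_right_cancel e

theorem eq_expSeries {f F : R⟦X⟧} (hf : constantCoeff f = 0) (h0 : coeff 0 F = 1)
    (hF : derivative R F = derivative R f * F) : F = expSeries f :=
  eq_of_derivative_eq_mul (by rw [h0, coeff_expSeries_zero]) hF (derivative_expSeries hf)

theorem expSeries_add {f g : R⟦X⟧} (hf : constantCoeff f = 0) (hg : constantCoeff g = 0) :
    expSeries (f + g) = expSeries f * expSeries g := by
  symm
  apply eq_expSeries
  · simp [hf, hg]
  · have h1 := coeff_expSeries_zero f
    have h2 := coeff_expSeries_zero g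
    simp only [coeff_zero_eq_constantCoeff] at *
    rw [map_mul, h1, h2, one_mul]
  · rw [Derivation.leibniz, derivative_expSeries hf, derivative_expSeries hg, map_add]
    simp only [smul_eq_mul]
    ring

theorem expSeries_rescale (u : R) (f : R⟦X⟧) :
    expSeries (rescale u f) = rescale u (expSeries f) := by
  ext n
  simp [expSeries, ← map_pow, coeff_rescale, Finset.mul_sum]

theorem xi_rescale (u : R) (a : ℕ+ → R) :
    xi (fun n => a n * u ^ (n : ℕ)) = rescale u (xi a) := by
  ext n
  simp only [xi, coeff_mk, coeff_rescale]
  split_ifs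
  · simp [mul_comm]
  · simp

/-- Homogeneity of `qₙ`. -/
theorem q_mul_pow (u : R) (a : ℕ+ → R) (n : ℕ) :
    q (fun k => a k * u ^ (k : ℕ)) n = q a n * u ^ n := by
  rw [q_natCast, q_natCast, xi_rescale, expSeries_rescale, coeff_rescale, mul_comm]

end Exponential

/-! ### Exponentials of commuting sequences; Newton's recurrence -/

section Commuting

open PowerSeries

variable {R : Type*} [Ring R] [Algebra K R]

theorem sum_antidiagonal_q (a b : ℕ+ → R) (n : ℤ) {N : ℕ} (hN : n < N) :
    ∑ p ∈ Finset.HasAntidiagonal.antidiagonal n.toNat, (if n < 0 then 0 else q a p.1 * q b p.2) =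
      ∑ k ∈ Finset.range N, q a k * q b (n - k) := by
  by_cases hn : n < 0
  · simp only [hn, if_true, Finset.sum_const_zero]
    symm
    refine Finset.sum_eq_zero fun k _ => ?_
    rw [q_of_neg b (by omega), mul_zero]
  · obtain ⟨m, rfl⟩ := Int.eq_ofNat_of_zero_le (not_lt.1 hn)
    simp only [hn, if_false, Int.toNat_natCast]
    rw [Finset.Nat.sum_antidiagonal_eq_sum_range_succ (fun i j => q a (i : ℤ) * q b (j : ℤ))]
    have h : m + 1 ≤ N := by exact_mod_cast hN
    rw [← Finset.sum_subset (Finset.range_mono h)]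
    · refine Finset.sum_congr rfl fun k hk => ?_
      rw [Nat.cast_sub (by simpa [Nat.lt_succ_iff] using hk)]
    · intro k _ hk
      rw [q_of_neg b, mul_zero]
      have : m < k := by simpa using hk
      omega

/-- `exp ξ(a + b) = exp ξ(a) exp ξ(b)` for commuting sequences, coefficient by coefficient. -/
theorem q_add (a b : ℕ+ → R) (haa : ∀ i j, Commute (a i) (a j)) (hbb : ∀ i j, Commute (b i) (b j))
    (hab : ∀ i j, Commute (a i) (b j)) (n : ℤ) {N : ℕ} (hN : n < N) :
    q (fun k => a k + b k) n = ∑ k ∈ Finset.range N, q a k * q b (n - k) := by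
  obtain ⟨C, _, _, φ, c, hc⟩ := exists_commRing_lift (Sum.elim a b) (by
    rintro (i | i) (j | j)
    · exact haa i j
    · exact hab i j
    · exact (hab j i).symm
    · exact hbb i j)
  have ha : ∀ i, φ (c (Sum.inl i)) = a i := fun i => hc (Sum.inl i)
  have hb : ∀ i, φ (c (Sum.inr i)) = b i := fun i => hc (Sum.inr i)
  have key : q (fun k => c (Sum.inl k) + c (Sum.inr k)) n =
      ∑ k ∈ Finset.range N, q (fun k => c (Sum.inl k)) k * q (fun k => c (Sum.inr k)) (n - k) := by
    rw [← sum_antidiagonal_q _ _ _ hN]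
    by_cases hn : n < 0
    · simp [hn, q_of_neg]
    · obtain ⟨m, rfl⟩ := Int.eq_ofNat_of_zero_le (not_lt.1 hn)
      simp only [hn, if_false, Int.toNat_natCast, q_natCast]
      rw [xi_add, expSeries_add (constantCoeff_xi _) (constantCoeff_xi _), coeff_mul]
  have := congrArg φ key
  simpa only [map_sum, map_mul, map_q, map_add, ha, hb] using this

theorem commute_q (a : ℕ+ → R) (h : ∀ i j, Commute (a i) (a j)) (m n : ℤ) :
    Commute (q a m) (q a n) := by
  obtain ⟨C, _, _, φ, c, hc⟩ := exists_commRing_lift a h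
  have : ∀ n, q a n = φ (q c n) := fun n => by rw [map_q]; simp only [hc]
  rw [this, this]
  exact (Commute.all _ _).map φ

/-- Newton's recurrence for the coefficients of `exp ξ(a)`. -/
theorem smul_q (a : ℕ+ → R) (h : ∀ i j, Commute (a i) (a j)) (n : ℤ) {N : ℕ} (hN : n ≤ N) :
    (n : K) • q a n = ∑ i ∈ Finset.range N,
      (((i : K) + 1) * (1 - t ^ (i + 1))) • (a i.succPNat * q a (n - (i + 1))) := by
  obtain ⟨C, _, _, φ, c, hc⟩ := exists_commRing_lift a h
  have key : (n : K) • q c n = ∑ i ∈ Finset.range N,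
      (((i : K) + 1) * (1 - t ^ (i + 1))) • (c i.succPNat * q c (n - (i + 1))) := by
    rcases lt_or_ge n 1 with hn | hn
    · rw [Finset.sum_eq_zero fun i _ => by rw [q_of_neg c (by omega), mul_zero, smul_zero]]
      rcases lt_or_eq_of_le (Int.lt_add_one_iff.1 (show n < 0 + 1 by omega)) with h | rfl
      · rw [q_of_neg c h, smul_zero]
      · simp
    · obtain ⟨m, rfl⟩ : ∃ m : ℕ, n = m + 1 := ⟨(n - 1).toNat, by omega⟩
      have e := congrArg (coeff m) (derivative_expSeries (constantCoeff_xi c))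
      rw [coeff_derivative, coeff_mul, Finset.Nat.sum_antidiagonal_eq_sum_range_succ
        (fun i j => coeff i (derivative C (xi c)) * coeff j (expSeries (xi c)))] at e
      rw [← Finset.sum_subset (Finset.range_mono (show m + 1 ≤ N by exact_mod_cast hN))]
      · have e1 : (((m : ℤ) + 1 : ℤ) : K) • q c ((m : ℤ) + 1) =
            coeff (m + 1) (expSeries (xi c)) * ((m : C) + 1) := by
          rw [show ((m : ℤ) + 1) = ((m + 1 : ℕ) : ℤ) by push_cast; rfl, q_natCast,
            Algebra.smul_def]
          simp [mul_comm]
        rw [e1, e]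
        refine Finset.sum_congr rfl fun i hi => ?_
        have hi' : i ≤ m := by simpa [Nat.lt_succ_iff] using hi
        rw [show (m : ℤ) + 1 - ((i : ℤ) + 1) = ((m - i : ℕ) : ℤ) by omega, q_natCast,
          coeff_derivative, xi, coeff_mk, dif_pos (Nat.succ_pos i), Algebra.smul_def,
          Algebra.smul_def]
        simp only [map_mul, map_add, map_natCast, map_one, Nat.succPNat, Nat.succ_eq_add_one]
        ring
      · intro i _ hi
        have : m + 1 ≤ i := by simpa using hi
        rw [q_of_neg c (by omega), mul_zero, smul_zero]
  have := congrArg φ key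
  simpa only [map_sum, map_mul, map_q, map_smul, hc] using this

/-- For `n > 0` the recurrence can be divided by `n`, so it determines the whole sequence. This is
how a translation is recognised as the exponential of a derivation. -/
theorem eq_q_of_recurrence (a : ℕ+ → R) (h : ∀ i j, Commute (a i) (a j)) (e : ℤ → R)
    (hneg : ∀ n < 0, e n = 0) (h0 : e 0 = 1)
    (he : ∀ (n : ℤ) (N : ℕ), n ≤ N → (n : K) • e n = ∑ i ∈ Finset.range N,
      (((i : K) + 1) * (1 - t ^ (i + 1))) • (a i.succPNat * e (n - (i + 1)))) (n : ℤ) :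
    e n = q a n := by
  rcases lt_or_ge n 0 with hn | hn
  · rw [hneg n hn, q_of_neg a hn]
  · obtain ⟨m, rfl⟩ := Int.eq_ofNat_of_zero_le hn
    clear hn
    induction m using Nat.strong_induction_on with
    | _ m ih =>
      rcases Nat.eq_zero_or_pos m with rfl | hm
      · rw [Nat.cast_zero, h0, q_zero]
      · have hK : ((m : ℤ) : K) ≠ 0 := by exact_mod_cast hm.ne'
        have e1 : ((m : ℤ) : K) • e m = ((m : ℤ) : K) • q a m := by
          rw [he m m le_rfl, smul_q a h m le_rfl]
          refine Finset.sum_congr rfl fun i hi => ?_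
          have hi' : i < m := by simpa using hi
          rw [show (m : ℤ) - (i + 1) = ((m - (i + 1) : ℕ) : ℤ) by omega, ih _ (by omega)]
        have := congrArg (fun v => ((m : ℤ) : K)⁻¹ • v) e1
        simpa only [smul_smul, inv_mul_cancel₀ hK, one_smul] using this

end Commuting

/-! ### Operator factors as exponentials -/

section GeometricSeries

open PowerSeries

theorem inv_one_sub_C_mul_X (c : K) : (1 - C c * X : K⟦X⟧)⁻¹ = mk fun n => c ^ n := by
  symm
  rw [PowerSeries.eq_inv_iff_mul_eq_one (by simp)]
  ext n
  rw [mul_sub, mul_one, ← mul_assoc, mul_comm _ (C c)]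
  rcases n with _ | n
  · simp
  · rw [map_sub, coeff_mk, coeff_succ_mul_X, coeff_C_mul, coeff_mk, coeff_one]
    simp [pow_succ']

theorem inv_one_sub_mul_cancel (c : K) :
    (1 - C c * X : K⟦X⟧)⁻¹ * (1 - C c * X) = 1 :=
  PowerSeries.inv_mul_cancel _ (by simp)

theorem derivative_inv_one_sub (c : K) :
    derivative K (1 - C c * X : K⟦X⟧)⁻¹ = C c * (1 - C c * X : K⟦X⟧)⁻¹ ^ 2 := by
  rw [derivative_inv']
  simp [Derivation.leibniz]
  ring

/-- The weights of the shift of the `xₙ` by which the raising operators arise. -/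
def raiseWeight (n : ℕ+) : K := -((n : ℕ) : K)⁻¹

/-- The weights of the shift of the `yₙ` by which the lowering operators arise. -/
def lowerWeight (n : ℕ+) : K := -((n : ℕ) : K)⁻¹ * (1 - t ^ (n : ℕ))

/-- Here `-∑ (1 - tⁿ)zⁿ/n = log(1 - z) - log(1 - tz)`; the proof compares logarithmic derivatives.
-/
theorem raiseCoeff_eq (k : ℕ) : raiseCoeff k = q raiseWeight k := by
  rw [q_natCast, raiseCoeff]
  congr 1
  apply eq_expSeries (constantCoeff_xi _)
  · simp
  have h : derivative K (xi raiseWeight) =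
      -(1 - C 1 * X : K⟦X⟧)⁻¹ + C t * (1 - C t * X : K⟦X⟧)⁻¹ := by
    ext n
    rw [inv_one_sub_C_mul_X, inv_one_sub_C_mul_X]
    have h1 : ((n : K) + 1) ≠ 0 := by exact_mod_cast Nat.succ_ne_zero n
    simp only [coeff_derivative, xi, coeff_mk, map_add, map_neg, coeff_C_mul, dif_pos n.succ_pos,
      raiseWeight, smul_eq_mul, one_pow, PNat.mk_coe]
    push_cast
    field_simp
    ring
  have e1 := inv_one_sub_mul_cancel 1
  rw [h, Derivation.leibniz, derivative_inv_one_sub]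
  simp only [map_sub, derivative_one, derivative_X, smul_eq_mul, map_one, one_mul] at e1 ⊢
  linear_combination (1 - C t * X : K⟦X⟧)⁻¹ * e1

/-- As for `raiseCoeff_eq`, now with `-∑ (1 - tⁿ)²zⁿ/n = log(1 - z) - 2 log(1 - tz) + log(1 - t²z)`.
-/
theorem lowerCoeff_eq (k : ℕ) : lowerCoeff k = q lowerWeight k := by
  rw [q_natCast, lowerCoeff]
  congr 1
  apply eq_expSeries (constantCoeff_xi _)
  · simp
  have h : derivative K (xi lowerWeight) =
      -(1 - C 1 * X : K⟦X⟧)⁻¹ + 2 * C t * (1 - C t * X : K⟦X⟧)⁻¹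
        - C (t ^ 2) * (1 - C (t ^ 2) * X : K⟦X⟧)⁻¹ := by
    ext n
    rw [inv_one_sub_C_mul_X, inv_one_sub_C_mul_X, inv_one_sub_C_mul_X, mul_assoc, two_mul]
    have h1 : ((n : K) + 1) ≠ 0 := by exact_mod_cast Nat.succ_ne_zero n
    simp only [coeff_derivative, xi, coeff_mk, map_add, map_neg, map_sub, coeff_C_mul,
      dif_pos n.succ_pos, lowerWeight, smul_eq_mul, one_pow, PNat.mk_coe]
    push_cast
    field_simp
    ring
  have e1 := inv_one_sub_mul_cancel 1
  have e2 := inv_one_sub_mul_cancel (t ^ 2)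
  rw [h]
  simp only [Derivation.leibniz, derivative_inv_one_sub]
  simp only [map_sub, derivative_one, derivative_X, smul_eq_mul, map_one, one_mul,
    Derivation.leibniz, derivative_C] at e1 ⊢
  generalize (1 - C t * X : K⟦X⟧)⁻¹ = g at *
  generalize (1 - C (t ^ 2) * X : K⟦X⟧)⁻¹ = g2 at *
  generalize (1 - X : K⟦X⟧)⁻¹ = g1 at *
  linear_combination (1 - C (t ^ 2) * X : K⟦X⟧) * g ^ 2 * e1 + C (t ^ 2) * (1 - X) * g ^ 2 * e2

theorem q_raiseWeight_sub (k : ℤ) :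
    q raiseWeight k - t * q raiseWeight (k - 1) =
      (if k = 0 then 1 else 0) - (if k = 1 then 1 else 0) := by
  rcases lt_trichotomy k 0 with hk | rfl | hk
  · rw [q_of_neg _ hk, q_of_neg _ (by omega), if_neg (by omega), if_neg (by omega)]
    simp
  · rw [q_zero, q_of_neg _ (by omega)]
    simp
  · obtain ⟨n, rfl⟩ : ∃ n : ℕ, k = n + 1 := ⟨(k - 1).toNat, by omega⟩
    have h := congrArg (coeff (n + 1))
      (show (1 - X) * (1 - C t * X)⁻¹ * (1 - C t * X) = (1 - X : K⟦X⟧) by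
        rw [mul_assoc, inv_one_sub_mul_cancel, mul_one])
    rw [mul_sub, mul_one, ← mul_assoc _ _ X, mul_comm _ (C t), map_sub, coeff_succ_mul_X,
      coeff_C_mul] at h
    change raiseCoeff (n + 1) - t * raiseCoeff n = _ at h
    rw [raiseCoeff_eq, raiseCoeff_eq] at h
    rw [add_sub_cancel_right]
    push_cast at h
    rw [h, map_sub, coeff_one, coeff_X]
    have hn : (n : ℤ) + 1 ≠ 0 := by omega
    simp [hn]

end GeometricSeries

/-! ### Translations of the variables and Taylor's formula -/

section Shift

open Polynomial

/-- The subscript of a variable. -/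
def idx : ℕ+ ⊕ ℕ+ → ℕ := Sum.elim (fun n => n) (fun n => n)

/-- The substitution `X_v ↦ X_v + w_v u^{idx v}`. -/
def shift (w : ℕ+ ⊕ ℕ+ → K) : A →ₐ[K] A[X] :=
  MvPolynomial.aeval fun v => C (MvPolynomial.X v) + C (MvPolynomial.C (w v)) * X ^ idx v

/-- The coefficient of a polynomial, extended by zero to negative exponents. -/
def intCoeff (j : ℤ) : A[X] →ₗ[A] A := if j < 0 then 0 else lcoeff A j.toNat

theorem intCoeff_natCast (j : ℕ) (p : A[X]) : intCoeff j p = p.coeff j := by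
  rw [intCoeff, if_neg (by omega), Int.toNat_natCast, lcoeff_apply]

theorem intCoeff_of_neg {j : ℤ} (hj : j < 0) (p : A[X]) : intCoeff j p = 0 := by
  simp [intCoeff, hj]

theorem intCoeff_mul_C (j : ℤ) (p : A[X]) (a : A) : intCoeff j (p * C a) = intCoeff j p * a := by
  rw [mul_comm, ← smul_eq_C_mul, map_smul, smul_eq_mul, mul_comm]

theorem intCoeff_C_mul (j : ℤ) (p : A[X]) (a : A) : intCoeff j (C a * p) = a * intCoeff j p := by
  rw [← smul_eq_C_mul, map_smul, smul_eq_mul]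

theorem intCoeff_mul_X_pow (j : ℤ) (p : A[X]) (i : ℕ) :
    intCoeff j (p * X ^ i) = intCoeff (j - i) p := by
  rcases lt_or_ge j 0 with hj | hj
  · rw [intCoeff_of_neg hj, intCoeff_of_neg (by omega)]
  · obtain ⟨m, rfl⟩ := Int.eq_ofNat_of_zero_le hj
    rw [intCoeff_natCast, coeff_mul_X_pow']
    split_ifs with h
    · rw [← Nat.cast_sub h, intCoeff_natCast]
    · rw [intCoeff_of_neg (by omega)]

theorem intCoeff_C (j : ℤ) (a : A) : intCoeff j (C a) = if j = 0 then a else 0 := by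
  rcases lt_or_ge j 0 with hj | hj
  · rw [intCoeff_of_neg hj, if_neg (by omega)]
  · obtain ⟨m, rfl⟩ := Int.eq_ofNat_of_zero_le hj
    rw [intCoeff_natCast, coeff_C]
    simp

/-- The coefficient of `uʲ` in `shift w`. -/
def shiftCoeff (w : ℕ+ ⊕ ℕ+ → K) (j : ℤ) : A →ₗ[K] A :=
  (intCoeff j).restrictScalars K ∘ₗ (shift w).toLinearMap

theorem shiftCoeff_apply (w : ℕ+ ⊕ ℕ+ → K) (j : ℤ) (f : A) :
    shiftCoeff w j f = intCoeff j (shift w f) := rfl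

theorem shiftCoeff_of_neg (w : ℕ+ ⊕ ℕ+ → K) {j : ℤ} (hj : j < 0) (f : A) :
    shiftCoeff w j f = 0 :=
  intCoeff_of_neg hj _

theorem shiftCoeff_mul_X (w : ℕ+ ⊕ ℕ+ → K) (j : ℤ) (f : A) (v : ℕ+ ⊕ ℕ+) :
    shiftCoeff w j (f * MvPolynomial.X v) =
      shiftCoeff w j f * MvPolynomial.X v + w v • shiftCoeff w (j - idx v) f := by
  simp only [shiftCoeff_apply, map_mul]
  rw [show shift w (MvPolynomial.X v) =
    C (MvPolynomial.X v) + C (MvPolynomial.C (w v)) * X ^ idx v by simp [shift]]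
  rw [mul_add, map_add, intCoeff_mul_C, mul_left_comm, intCoeff_C_mul, intCoeff_mul_X_pow,
    MvPolynomial.smul_eq_C_mul]

theorem shiftCoeff_C (w : ℕ+ ⊕ ℕ+ → K) (j : ℤ) (a : K) :
    shiftCoeff w j (MvPolynomial.C a) = if j = 0 then MvPolynomial.C a else 0 := by
  rw [shiftCoeff_apply, ← intCoeff_C]
  congr 1
  simp [shift, MvPolynomial.algebraMap_eq]

theorem shiftCoeff_zero (w : ℕ+ ⊕ ℕ+ → K) (f : A) : shiftCoeff w 0 f = f := by
  induction f using MvPolynomial.induction_on with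
  | C a => simp [shiftCoeff_C]
  | add f g hf hg => rw [map_add, hf, hg]
  | mul_X f v hf =>
    have : 0 < idx v := by rcases v with v | v <;> exact v.pos
    rw [shiftCoeff_mul_X, hf, shiftCoeff_of_neg w (by omega), smul_zero, add_zero]

theorem shiftCoeff_comm (w w' : ℕ+ ⊕ ℕ+ → K) (j k : ℤ) (f : A) :
    shiftCoeff w j (shiftCoeff w' k f) = shiftCoeff w' k (shiftCoeff w j f) := by
  induction f using MvPolynomial.induction_on generalizing j k with
  | C a =>
    rw [shiftCoeff_C, shiftCoeff_C]
    split_ifs <;> simp [shiftCoeff_C, *]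
  | add f g hf hg => simp only [map_add, hf, hg]
  | mul_X f v hf =>
    simp only [shiftCoeff_mul_X, map_add, map_smul, hf]
    abel

/-- A translated polynomial is still a polynomial in `u`; this makes the infinite sums defining the
vertex operators locally finite. -/
theorem exists_shiftCoeff_eq_zero (w : ℕ+ ⊕ ℕ+ → K) (f : A) :
    ∃ N : ℕ, ∀ k : ℤ, N ≤ k → shiftCoeff w k f = 0 := by
  refine ⟨(shift w f).natDegree + 1, fun k hk => ?_⟩
  obtain ⟨m, rfl⟩ := Int.eq_ofNat_of_zero_le (show 0 ≤ k by omega)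
  rw [shiftCoeff_apply, intCoeff_natCast]
  exact coeff_eq_zero_of_natDegree_lt (by omega)

/-- The weights that leave the `xₙ` fixed. -/
def yWeight (b : ℕ+ → K) : ℕ+ ⊕ ℕ+ → K := Sum.elim (fun _ => 0) b

/-- The weights that leave the `yₙ` fixed. -/
def xWeight (b : ℕ+ → K) : ℕ+ ⊕ ℕ+ → K := Sum.elim b fun _ => 0

/-- Taylor's formula for `shift`, as a recurrence. -/
theorem smul_shiftCoeff (b : ℕ+ → K) (f : A) (N : ℕ) (j : ℤ) (hj : j ≤ N) :
    (j : K) • shiftCoeff (yWeight b) j f = ∑ i ∈ Finset.range N,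
      (((i : K) + 1) * b i.succPNat) • MvPolynomial.pderiv (Sum.inr i.succPNat)
        (shiftCoeff (yWeight b) (j - (i + 1)) f) := by
  induction f using MvPolynomial.induction_on generalizing j with
  | C a =>
    rw [shiftCoeff_C, Finset.sum_eq_zero]
    · by_cases h : j = 0 <;> simp [h]
    · intro i _
      rw [shiftCoeff_C]
      split_ifs <;> simp
  | add f g hf hg => simp only [map_add, smul_add, hf j hj, hg j hj, Finset.sum_add_distrib]
  | mul_X f v hf =>
    have key : ∀ i : ℕ, MvPolynomial.pderiv (Sum.inr i.succPNat)
        (shiftCoeff (yWeight b) (j - (i + 1)) (f * MvPolynomial.X v)) =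
        MvPolynomial.pderiv (Sum.inr i.succPNat) (shiftCoeff (yWeight b) (j - (i + 1)) f) *
          MvPolynomial.X v +
        (if v = Sum.inr i.succPNat then shiftCoeff (yWeight b) (j - (i + 1)) f else 0) +
        yWeight b v • MvPolynomial.pderiv (Sum.inr i.succPNat)
          (shiftCoeff (yWeight b) (j - idx v - (i + 1)) f) := by
      intro i
      rw [shiftCoeff_mul_X, map_add, Derivation.leibniz, Derivation.map_smul, MvPolynomial.pderiv_X,
        sub_right_comm j (idx v : ℤ)]
      simp only [smul_eq_mul, Pi.single_apply, mul_ite, mul_one, mul_zero]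
      simp only [eq_comm (a := v)]
      ring
    have hidx : 0 < idx v := by rcases v with v | v <;> exact v.pos
    simp only [key, smul_add, Finset.sum_add_distrib]
    simp only [smul_comm _ (yWeight b v), ← Finset.smul_sum]
    rw [← hf (j - idx v) (by omega), shiftCoeff_mul_X, smul_add, ← smul_mul_assoc, hf j hj,
      Finset.sum_mul]
    simp only [smul_mul_assoc, add_assoc]
    congr 1
    -- What remains is the discrepancy between the factors `j` and `j - idx v`. It comes from the
    -- one derivative that hits the variable `v` itself; for an `x` variable the weight is zero and
    -- no derivative hits it.
    rcases v with v | m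
    · simp [yWeight]
    · have hs : ∀ i : ℕ, (Sum.inr m = (Sum.inr i.succPNat : ℕ+ ⊕ ℕ+)) ↔ (m : ℕ) - 1 = i := by
        intro i
        rw [Sum.inr.injEq, ← PNat.coe_inj, Nat.succPNat_coe]
        have := m.pos
        omega
      simp only [hs, smul_ite, smul_zero, Finset.sum_ite_eq, Finset.mem_range]
      have hm := m.pos
      have hm' : ((m : ℕ) - 1).succPNat = m := by
        rw [← PNat.coe_inj, Nat.succPNat_coe]
        omega
      have hc : (((m : ℕ) - 1 : ℕ) : K) + 1 = (m : ℕ) := by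
        exact_mod_cast congrArg (Nat.cast : ℕ → K) (show (m : ℕ) - 1 + 1 = m by omega)
      have hz : (((m : ℕ) - 1 : ℕ) : ℤ) + 1 = (m : ℕ) := by omega
      rw [hm', hc, hz]
      simp only [yWeight, Sum.elim_inr, idx]
      split_ifs with h
      · rw [smul_smul, smul_smul, ← add_smul]
        congr 1
        push_cast
        ring
      -- Here `m > N ≥ j`, so the missing derivative would meet a negative exponent.
      · rw [shiftCoeff_of_neg _ (by omega)]
        simp

end Shift

/-! ### Translations of the functions `q` -/

section ShiftQ

open Polynomial

/-- The exponential of a sum factors, and homogeneity collects the powers of `u`. -/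
theorem shift_q (ι : ℕ+ → ℕ+ ⊕ ℕ+) (hι : ∀ n, idx (ι n) = n) (w : ℕ+ ⊕ ℕ+ → K) (m : ℤ)
    {N : ℕ} (hN : m < N) :
    shift w (q (fun n => (MvPolynomial.X (ι n) : A)) m) = ∑ k ∈ Finset.range N,
      C (q (fun n => w (ι n)) k • q (fun n => (MvPolynomial.X (ι n) : A)) (m - k)) * X ^ k := by
  rw [map_q]
  have e : (fun k => shift w (MvPolynomial.X (ι k))) =
      fun k => algebraMap K A[X] (w (ι k)) * X ^ (k : ℕ) + C (MvPolynomial.X (ι k)) := by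
    funext k
    rw [shift, MvPolynomial.aeval_X, hι, add_comm]
    rfl
  rw [e, q_add _ _ (fun _ _ => Commute.all _ _) (fun _ _ => Commute.all _ _)
    (fun _ _ => Commute.all _ _) m hN]
  refine Finset.sum_congr rfl fun k _ => ?_
  rw [q_mul_pow]
  have h1 : q (fun k => algebraMap K A[X] (w (ι k))) k =
      algebraMap K A[X] (q (fun k => w (ι k)) k) :=
    (map_q (Algebra.ofId K A[X]) (fun k => w (ι k)) k).symm
  have h2 : q (fun k => (C (MvPolynomial.X (ι k)) : A[X])) (m - k) =
      C (q (fun n => (MvPolynomial.X (ι n) : A)) (m - k)) :=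
    (map_q (Algebra.ofId A A[X] |>.restrictScalars K) (fun k => (MvPolynomial.X (ι k) : A))
      (m - k)).symm
  rw [h1, h2, MvPolynomial.smul_eq_C_mul, C_mul]
  change C (MvPolynomial.C _) * X ^ k * _ = _
  ring

theorem shiftCoeff_q (ι : ℕ+ → ℕ+ ⊕ ℕ+) (hι : ∀ n, idx (ι n) = n) (w : ℕ+ ⊕ ℕ+ → K)
    (j m : ℤ) :
    shiftCoeff w j (q (fun n => (MvPolynomial.X (ι n) : A)) m) =
      q (fun n => w (ι n)) j • q (fun n => (MvPolynomial.X (ι n) : A)) (m - j) := by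
  rcases lt_or_ge j 0 with hj | hj
  · rw [shiftCoeff_of_neg w hj, q_of_neg _ hj, zero_smul]
  · obtain ⟨i, rfl⟩ := Int.eq_ofNat_of_zero_le hj
    rw [shiftCoeff_apply, shift_q ι hι w m (N := m.toNat + i + 1) (by omega), map_sum,
      Finset.sum_eq_single i]
    · rw [intCoeff_mul_X_pow, sub_self, intCoeff_C, if_pos rfl]
    · intro k _ hk
      rw [intCoeff_mul_X_pow, intCoeff_C, if_neg (by omega)]
    · intro h
      exact absurd (Finset.mem_range.2 (by omega)) h

theorem shift_q_of_eq_zero (ι : ℕ+ → ℕ+ ⊕ ℕ+) (w : ℕ+ ⊕ ℕ+ → K)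
    (hw : ∀ n, w (ι n) = 0) (m : ℤ) :
    shift w (q (fun n => (MvPolynomial.X (ι n) : A)) m) =
      C (q (fun n => (MvPolynomial.X (ι n) : A)) m) := by
  rw [map_q]
  have e : (fun k => shift w (MvPolynomial.X (ι k))) =
      fun k => (Algebra.ofId A A[X] |>.restrictScalars K) (MvPolynomial.X (ι k)) := by
    funext k
    rw [shift, MvPolynomial.aeval_X, hw]
    simp
  rw [e, ← map_q]
  rfl

end ShiftQ

theorem idx_inl (n : ℕ+) : idx (Sum.inl n) = n := rfl

theorem idx_inr (n : ℕ+) : idx (Sum.inr n) = n := rfl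

/-- The coefficients of the shift of the `xₙ` by `raiseWeight`. -/
abbrev xShift (k : ℤ) : A →ₗ[K] A := shiftCoeff (xWeight raiseWeight) k

/-- The coefficients of the shift of the `yₙ` by `lowerWeight`. -/
abbrev yShift (k : ℤ) : A →ₗ[K] A := shiftCoeff (yWeight lowerWeight) k

/-- The translation multiplies `exp ξ_t(x, z)` by `(1 - uz)/(1 - tuz)`. Clearing the denominator
leaves a two-term relation, from which both relations of the vertex operators descend. -/
theorem xShift_q_mul_sub (k m : ℤ) (g : A) :
    xShift k (q x m * g) - t • xShift (k - 1) (q x (m - 1) * g) =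
      q x m * xShift k g - q x (m - 1) * xShift (k - 1) g := by
  have key : shift (xWeight raiseWeight) (q x m) -
      Polynomial.C (MvPolynomial.C t) * shift (xWeight raiseWeight) (q x (m - 1)) *
        Polynomial.X ^ 1 =
      Polynomial.C (q x m) - Polynomial.C (q x (m - 1)) * Polynomial.X ^ 1 := by
    ext1 n
    have hx : ∀ i l : ℤ, intCoeff i (shift (xWeight raiseWeight) (q x l)) =
        q raiseWeight i • q x (l - i) := fun i l => shiftCoeff_q Sum.inl idx_inl _ i l
    rw [← intCoeff_natCast, ← intCoeff_natCast, map_sub, map_sub, intCoeff_mul_X_pow,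
      intCoeff_mul_X_pow, intCoeff_C_mul, hx, hx, intCoeff_C, intCoeff_C,
      ← MvPolynomial.smul_eq_C_mul, smul_smul]
    rw [show m - 1 - ((n : ℤ) - (1 : ℕ)) = m - n by push_cast; ring, ← sub_smul]
    push_cast
    rw [q_raiseWeight_sub]
    by_cases h0 : (n : ℤ) = 0
    · simp [h0]
    · by_cases h1 : (n : ℤ) = 1
      · simp [h1]
      · have h1' : (n : ℤ) - 1 ≠ 0 := by omega
        rw [if_neg h0, if_neg h1, if_neg h0, if_neg h1']
        simp
  have := congrArg (fun p => intCoeff k (p * shift (xWeight raiseWeight) g)) key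
  simp only [sub_mul, map_sub] at this
  rw [mul_right_comm, intCoeff_mul_X_pow, mul_assoc, intCoeff_C_mul, intCoeff_C_mul, mul_right_comm,
    intCoeff_mul_X_pow, intCoeff_C_mul, ← MvPolynomial.smul_eq_C_mul, ← map_mul, ← map_mul] at this
  exact_mod_cast this

theorem yShift_q_mul (k m : ℤ) (g : A) : yShift k (q x m * g) = q x m * yShift k g := by
  rw [shiftCoeff_apply, map_mul]
  have : shift (yWeight lowerWeight) (q x m) = Polynomial.C (q x m) :=
    shift_q_of_eq_zero Sum.inl _ (fun _ => rfl) m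
  rw [this, intCoeff_C_mul]
  rfl

/-! ### Vertex operators and their commutation relations -/

section VertexOperators

/-- The annihilation part `-(1/n) ∂/∂yₙ` of `xOp n`. -/
def yDeriv (n : ℕ+) : Module.End K A :=
  -(((n : ℕ) : K)⁻¹ • (MvPolynomial.pderiv (Sum.inr n)).toLinearMap)

theorem yDeriv_apply (n : ℕ+) (f : A) :
    yDeriv n f = -(((n : ℕ) : K)⁻¹ • MvPolynomial.pderiv (Sum.inr n) f) := rfl

theorem pderiv_comm {σ R : Type*} [CommRing R] (i j : σ) (f : MvPolynomial σ R) :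
    MvPolynomial.pderiv i (MvPolynomial.pderiv j f) =
      MvPolynomial.pderiv j (MvPolynomial.pderiv i f) := by
  classical
  have h : ⁅(MvPolynomial.pderiv i : Derivation R (MvPolynomial σ R) (MvPolynomial σ R)),
      (MvPolynomial.pderiv j : Derivation R (MvPolynomial σ R) (MvPolynomial σ R))⁆ = 0 := by
    refine MvPolynomial.derivation_ext fun v => ?_
    rw [Derivation.commutator_apply]
    simp only [MvPolynomial.pderiv_X]
    by_cases h1 : i = v <;> by_cases h2 : j = v <;> simp [h1, h2]
  have := congrArg (fun D => D f) h
  rw [Derivation.commutator_apply] at this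
  exact sub_eq_zero.1 this

theorem commute_yDeriv (i j : ℕ+) : Commute (yDeriv i) (yDeriv j) := by
  refine LinearMap.ext fun f => ?_
  simp only [Module.End.mul_apply, yDeriv_apply, map_neg, Derivation.map_smul, neg_neg]
  rw [smul_comm, pderiv_comm]

theorem commute_mulLeft_yDeriv (i j : ℕ+) :
    Commute (yDeriv i) (LinearMap.mulLeft K (x j) : Module.End K A) := by
  refine LinearMap.ext fun f => ?_
  simp only [Module.End.mul_apply, yDeriv_apply, LinearMap.mulLeft_apply, Derivation.leibniz]
  simp [x, MvPolynomial.pderiv_X]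

theorem commute_mulLeft (i j : ℕ+) :
    Commute (LinearMap.mulLeft K (x i) : Module.End K A) (LinearMap.mulLeft K (x j)) := by
  refine LinearMap.ext fun f => ?_
  simp only [Module.End.mul_apply, LinearMap.mulLeft_apply]
  ring

theorem xOp_eq : xOp = fun n => yDeriv n + LinearMap.mulLeft K (x n) := by
  funext n
  rw [xOp, yDeriv]
  abel

theorem commute_xOp (i j : ℕ+) : Commute (xOp i) (xOp j) := by
  rw [xOp_eq]
  exact ((commute_yDeriv i j).add_right (commute_mulLeft_yDeriv i j)).add_left
    ((commute_mulLeft_yDeriv j i).symm.add_right (commute_mulLeft i j))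

/-- Taylor's formula: the exponential of a constant-coefficient derivation is a translation. Both
sides satisfy Newton's recurrence, by `smul_shiftCoeff`. -/
theorem q_yDeriv (n : ℤ) : q yDeriv n = yShift n := by
  symm
  refine eq_q_of_recurrence yDeriv commute_yDeriv yShift ?_ ?_ ?_ n
  · intro n hn
    refine LinearMap.ext fun f => ?_
    exact shiftCoeff_of_neg _ hn f
  · refine LinearMap.ext fun f => ?_
    exact shiftCoeff_zero _ f
  · intro n N hN
    refine LinearMap.ext fun f => ?_
    rw [LinearMap.smul_apply, smul_shiftCoeff lowerWeight f N n hN, LinearMap.sum_apply]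
    refine Finset.sum_congr rfl fun i _ => ?_
    rw [LinearMap.smul_apply, Module.End.mul_apply, yDeriv_apply, lowerWeight, Nat.succPNat_coe,
      smul_neg, smul_smul, ← neg_smul]
    congr 1
    rw [Nat.succ_eq_add_one]
    ring

theorem q_mulLeft (n : ℤ) :
    q (fun k => (LinearMap.mulLeft K (x k) : Module.End K A)) n = LinearMap.mulLeft K (q x n) :=
  (map_q (Algebra.lmul K A) x n).symm

/-- `Γ₁⁻` as a translation of the `yₙ` followed by a multiplication. -/
theorem q_xOp_apply (n : ℤ) (f : A) {N : ℕ} (hN : n < N) :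
    q xOp n f = ∑ j ∈ Finset.range N, q x (n - j) * yShift j f := by
  rw [xOp_eq, q_add yDeriv _ commute_yDeriv commute_mulLeft commute_mulLeft_yDeriv n hN,
    LinearMap.sum_apply]
  refine Finset.sum_congr rfl fun j _ => ?_
  rw [Module.End.mul_apply, q_yDeriv, q_mulLeft, LinearMap.mulLeft_apply, yShift_q_mul]

theorem q_xOp_comm (m n : ℤ) (f : A) : q xOp m (q xOp n f) = q xOp n (q xOp m f) :=
  LinearMap.congr_fun (commute_q xOp commute_xOp m n) f

theorem xShift_q_xOp_sub (k m : ℤ) (f : A) :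
    xShift k (q xOp m f) - t • xShift (k - 1) (q xOp (m - 1) f) =
      q xOp m (xShift k f) - q xOp (m - 1) (xShift (k - 1) f) := by
  have h : ∀ g, q xOp m g = ∑ j ∈ Finset.range (m.toNat + 1), q x (m - j) * yShift j g :=
    fun g => q_xOp_apply m g (by omega)
  have h' : ∀ g, q xOp (m - 1) g =
      ∑ j ∈ Finset.range (m.toNat + 1), q x (m - j - 1) * yShift j g := fun g => by
    rw [q_xOp_apply (m - 1) g (N := m.toNat + 1) (by omega)]
    simp only [sub_right_comm]
  simp only [h, h', map_sum, Finset.smul_sum]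
  rw [← Finset.sum_sub_distrib, ← Finset.sum_sub_distrib]
  refine Finset.sum_congr rfl fun j _ => ?_
  rw [xShift_q_mul_sub, shiftCoeff_comm, shiftCoeff_comm (xWeight raiseWeight)]

/-- The operator that prepends the part `n` to the first index sequence. -/
def vertexOp (n : ℤ) : A →ₗ[K] A :=
  (Polynomial.lsum fun k => q xOp (n + k)) ∘ₗ (shift (xWeight raiseWeight)).toLinearMap

theorem vertexOp_apply (n : ℤ) (f : A) {N : ℕ} (hN : ∀ k : ℤ, N ≤ k → xShift k f = 0) :
    vertexOp n f = ∑ k ∈ Finset.range N, q xOp (n + k) (xShift k f) := by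
  have h : ∀ k : ℕ, xShift k f = (shift (xWeight raiseWeight) f).coeff k :=
    fun k => intCoeff_natCast k _
  simp only [h]
  rw [vertexOp, LinearMap.comp_apply, Polynomial.lsum_apply]
  refine Polynomial.sum_eq_of_subset _ (fun k => map_zero _) fun k hk => ?_
  by_contra hk'
  rw [Polynomial.mem_support_iff] at hk
  exact hk (by
    have : N ≤ k := by simpa using hk'
    exact (h k).symm.trans (hN k (by exact_mod_cast this)))

theorem vertexOp_add_one_apply (n : ℤ) (f : A) {N : ℕ}
    (hN : ∀ k : ℤ, N ≤ k → xShift k f = 0) :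
    vertexOp (n + 1) f = ∑ k ∈ Finset.range (N + 1), q xOp (n + k) (xShift (k - 1) f) := by
  rw [vertexOp_apply (n + 1) f hN, Finset.sum_range_succ', Nat.cast_zero,
    shiftCoeff_of_neg _ (show (0 : ℤ) - 1 < 0 by norm_num), map_zero, add_zero]
  refine Finset.sum_congr rfl fun k _ => ?_
  push_cast
  rw [add_sub_cancel_right, add_right_comm, add_assoc n]

/-- Termwise this is `xShift_q_xOp_sub`, since the `q xOp` commute among themselves. Writing the `n
+ 1` terms with the index moved by one aligns the sums. -/
theorem vertexOp_q_xOp (n m : ℤ) (f : A) :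
    vertexOp n (q xOp m f) - t • vertexOp (n + 1) (q xOp (m - 1) f) =
      q xOp m (vertexOp n f) - q xOp (m - 1) (vertexOp (n + 1) f) := by
  obtain ⟨N₁, h₁⟩ := exists_shiftCoeff_eq_zero (xWeight raiseWeight) f
  obtain ⟨N₂, h₂⟩ := exists_shiftCoeff_eq_zero (xWeight raiseWeight) (q xOp m f)
  obtain ⟨N₃, h₃⟩ := exists_shiftCoeff_eq_zero (xWeight raiseWeight) (q xOp (m - 1) f)
  let N := N₁ + N₂ + N₃
  rw [vertexOp_apply n (q xOp m f) (N := N + 1) (fun k hk => h₂ k (by omega)),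
    vertexOp_add_one_apply n (q xOp (m - 1) f) (N := N) (fun k hk => h₃ k (by omega)),
    vertexOp_apply n f (N := N + 1) (fun k hk => h₁ k (by omega)),
    vertexOp_add_one_apply n f (N := N) (fun k hk => h₁ k (by omega))]
  simp only [map_sum, Finset.smul_sum]
  rw [← Finset.sum_sub_distrib, ← Finset.sum_sub_distrib]
  refine Finset.sum_congr rfl fun k _ => ?_
  rw [← map_smul, ← map_sub, xShift_q_xOp_sub, map_sub, q_xOp_comm, q_xOp_comm (n + k)]

/-- The straightening relation of the vertex operators. -/
theorem vertexOp_vertexOp (n r : ℤ) (f : A) :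
    vertexOp n (vertexOp r f) - t • vertexOp (n + 1) (vertexOp (r - 1) f) =
      t • vertexOp r (vertexOp n f) - vertexOp (r - 1) (vertexOp (n + 1) f) := by
  obtain ⟨N, hN⟩ := exists_shiftCoeff_eq_zero (xWeight raiseWeight) f
  -- The normally ordered product, with all translations of the `xₙ` applied first; it is symmetric
  -- in the two indices.
  let S : ℤ → ℤ → A := fun n r => ∑ k ∈ Finset.range N, ∑ j ∈ Finset.range N,
    q xOp (r + k) (q xOp (n + j) (xShift j (xShift k f)))
  have hS : ∀ n r, S n r = S r n := by
    intro n r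
    simp only [S]
    rw [Finset.sum_comm]
    refine Finset.sum_congr rfl fun k _ => Finset.sum_congr rfl fun j _ => ?_
    rw [q_xOp_comm, shiftCoeff_comm]
  have key : ∀ n r : ℤ, vertexOp n (vertexOp r f) - t • vertexOp (n + 1) (vertexOp (r - 1) f) =
      S n r - S (n + 1) (r - 1) := by
    intro n r
    have hB : ∀ (n : ℤ) (k : ℕ), vertexOp n (xShift k f) =
        ∑ j ∈ Finset.range N, q xOp (n + j) (xShift j (xShift k f)) := fun n k =>
      vertexOp_apply n (xShift k f) fun j hj => by rw [shiftCoeff_comm, hN j hj, map_zero]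
    rw [vertexOp_apply r f hN, vertexOp_apply (r - 1) f hN]
    simp only [S, ← map_sum, ← hB]
    simp only [map_sum, Finset.smul_sum]
    rw [← Finset.sum_sub_distrib, ← Finset.sum_sub_distrib]
    refine Finset.sum_congr rfl fun k _ => ?_
    rw [show r - 1 + (k : ℤ) = r + k - 1 by ring, vertexOp_q_xOp]
  -- The same identity at `(r - 1, n + 1)` has the opposite right-hand side, by the symmetry of `S`.
  have h2 := key (r - 1) (n + 1)
  rw [sub_add_cancel, add_sub_cancel_right] at h2
  rw [key n r, hS n r, hS (n + 1) (r - 1), ← neg_sub (S (r - 1) (n + 1)), ← h2, neg_sub]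

end VertexOperators

/-! ### Vertex operators on products of the `q`'s -/

section Products

open Polynomial

theorem shift_prod_q_mul (ι : ℕ+ → ℕ+ ⊕ ℕ+) (hι : ∀ n, idx (ι n) = n) (w : ℕ+ ⊕ ℕ+ → K) {l : ℕ}
    (α : Fin l → ℤ) {N : ℕ} (hN : ∀ i, α i < N) (g : A) (hg : shift w g = C g) :
    shift w ((∏ i, q (fun n => (MvPolynomial.X (ι n) : A)) (α i)) * g) =
      ∑ k ∈ Fintype.piFinset fun _ : Fin l => Finset.range N,
        C ((∏ i, q (fun n => w (ι n)) (k i : ℤ)) •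
          ((∏ i, q (fun n => (MvPolynomial.X (ι n) : A)) (α i - k i)) * g)) *
            X ^ (∑ i, k i) := by
  rw [map_mul, map_prod, hg, Finset.prod_congr rfl fun i _ => shift_q ι hι w (α i) (hN i),
    Finset.prod_univ_sum, Finset.sum_mul]
  refine Finset.sum_congr rfl fun k _ => ?_
  rw [Finset.prod_mul_distrib, Finset.prod_pow_eq_pow_sum, ← map_prod, mul_right_comm, ← C_mul,
    Finset.prod_smul, smul_mul_assoc]

theorem lsum_C_mul_X_pow (F : ℕ → A →ₗ[K] A) (a : A) (k : ℕ) :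
    lsum F (C a * X ^ k) = F k a := by
  rw [C_mul_X_pow_eq_monomial, lsum_apply, sum_monomial_index _ _ (map_zero (F k))]

theorem q_xOp_eq_lsum (m : ℤ) (h : A) :
    q xOp m h = lsum (fun j => LinearMap.mulLeft K (q x (m - j)))
      (shift (yWeight lowerWeight) h) := by
  have hj : ∀ k : ℕ, yShift k h = (shift (yWeight lowerWeight) h).coeff k :=
    fun k => intCoeff_natCast k _
  rw [q_xOp_apply m h (N := m.toNat + (shift (yWeight lowerWeight) h).natDegree + 1) (by omega),
    lsum_apply, sum_over_range' _ _
      (m.toNat + (shift (yWeight lowerWeight) h).natDegree + 1) (by omega)]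
  · simp [hj]
  · simp

theorem qPair_eq_mul_left {l l' : ℕ} (α : Fin l → ℤ) (β : Fin l' → ℤ) :
    qPair α β = (∏ i, q (fun n => (MvPolynomial.X (Sum.inl n) : A)) (α i)) *
      ∏ a, q (fun n => (MvPolynomial.X (Sum.inr n) : A)) (β a) := rfl

theorem qPair_eq_mul_right {l l' : ℕ} (α : Fin l → ℤ) (β : Fin l' → ℤ) :
    qPair α β = (∏ a, q (fun n => (MvPolynomial.X (Sum.inr n) : A)) (β a)) *
      ∏ i, q (fun n => (MvPolynomial.X (Sum.inl n) : A)) (α i) := mul_comm _ _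

theorem q_xOp_qPair (m : ℤ) {l l' : ℕ} (α : Fin l → ℤ) (β : Fin l' → ℤ) {N : ℕ}
    (hN : ∀ a, β a < N) :
    q xOp m (qPair α β) = ∑ d ∈ Fintype.piFinset fun _ : Fin l' => Finset.range N,
      (∏ a, lowerCoeff (d a)) • (q x (m - ∑ a, (d a : ℤ)) * qPair α fun a => β a - d a) := by
  rw [q_xOp_eq_lsum, qPair_eq_mul_right, shift_prod_q_mul Sum.inr idx_inr _ β hN, map_sum]
  · refine Finset.sum_congr rfl fun d _ => ?_
    rw [lsum_C_mul_X_pow, map_smul, LinearMap.mulLeft_apply, ← qPair_eq_mul_right]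
    simp only [lowerCoeff_eq]
    push_cast
    rfl
  · rw [map_prod, map_prod]
    exact Finset.prod_congr rfl fun i _ => shift_q_of_eq_zero Sum.inl _ (fun _ => rfl) _

theorem vertexOp_qPair (n : ℤ) {l l' : ℕ} (α : Fin l → ℤ) (β : Fin l' → ℤ) {N : ℕ}
    (hα : ∀ i, α i < N) (hβ : ∀ a, β a < N) :
    vertexOp n (qPair α β) = ∑ k ∈ Fintype.piFinset fun _ : Fin l => Finset.range N,
      ∑ d ∈ Fintype.piFinset fun _ : Fin l' => Finset.range N,
        ((∏ i, raiseCoeff (k i)) * ∏ a, lowerCoeff (d a)) •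
          (q x (n + ∑ i, (k i : ℤ) - ∑ a, (d a : ℤ)) *
            qPair (fun i => α i - k i) fun a => β a - d a) := by
  rw [vertexOp, LinearMap.comp_apply, AlgHom.toLinearMap_apply, qPair_eq_mul_left,
    shift_prod_q_mul Sum.inl idx_inl _ α hα, map_sum]
  · refine Finset.sum_congr rfl fun k _ => ?_
    rw [lsum_C_mul_X_pow, map_smul, ← qPair_eq_mul_left, q_xOp_qPair _ _ _ hβ, Finset.smul_sum]
    refine Finset.sum_congr rfl fun d _ => ?_
    rw [smul_smul]
    simp only [raiseCoeff_eq]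
    push_cast
    rfl
  · rw [map_prod, map_prod]
    exact Finset.prod_congr rfl fun i _ => shift_q_of_eq_zero Sum.inr _ (fun _ => rfl) _

theorem vertexOp_qPair_finsum (n : ℤ) {l l' : ℕ} (α : Fin l → ℤ) (β : Fin l' → ℤ) :
    vertexOp n (qPair α β) = ∑ᶠ s : (Fin l → ℕ) × (Fin l' → ℕ),
        ((∏ i, raiseCoeff (s.1 i)) * ∏ a, lowerCoeff (s.2 a)) •
          (q x (n + ∑ i, (s.1 i : ℤ) - ∑ a, (s.2 a : ℤ)) *
            qPair (fun i => α i - s.1 i) fun a => β a - s.2 a) := by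
  classical
  obtain ⟨M, hM⟩ : ∃ M : ℤ, ∀ i, α i ≤ M := by
    obtain ⟨M, hM⟩ := (Set.finite_range α).bddAbove
    exact ⟨M, fun i => hM ⟨i, rfl⟩⟩
  obtain ⟨M', hM'⟩ : ∃ M : ℤ, ∀ i, β i ≤ M := by
    obtain ⟨M, hM⟩ := (Set.finite_range β).bddAbove
    exact ⟨M, fun i => hM ⟨i, rfl⟩⟩
  let N := M.toNat + M'.toNat + 1
  have hα : ∀ i, α i < N := fun i => by have := hM i; omega
  have hβ : ∀ i, β i < N := fun i => by have := hM' i; omega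
  rw [vertexOp_qPair n α β hα hβ, ← Finset.sum_product']
  symm
  refine finsum_eq_sum_of_support_subset _ fun s hs => ?_
  have hq : qPair (fun i => α i - s.1 i) (fun a => β a - s.2 a) ≠ 0 := by
    intro h
    exact hs (by simp only [h, mul_zero, smul_zero])
  simp only [Finset.coe_product, Set.mem_prod, Finset.mem_coe, Fintype.mem_piFinset,
    Finset.mem_range]
  constructor
  · intro i
    by_contra hi
    refine hq ?_
    have := hα i
    rw [qPair, Finset.prod_eq_zero (Finset.mem_univ i) (q_of_neg x (by omega)), zero_mul]
  · intro i
    by_contra hi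
    refine hq ?_
    have := hβ i
    rw [qPair, Finset.prod_eq_zero (Finset.mem_univ i) (q_of_neg y (by omega)), mul_zero]

end Products

/-! ### Prepending a row to the raising operator formula -/

section Prepend

/-- The pairs `i < j` in `{0, …, l}` are the pairs `(0, j)` and the shifted pairs in
`{0, …, l - 1}`. -/
def pairsEquiv (l : ℕ) : Fin l ⊕ Pairs l ≃ Pairs (l + 1) :=
  Equiv.ofBijective
    (Sum.elim (fun j => ⟨(0, j.succ), Fin.succ_pos j⟩)
      fun p => ⟨(p.1.1.succ, p.1.2.succ), Fin.succ_lt_succ_iff.2 p.2⟩) <| by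
    constructor
    · rintro (i | ⟨⟨i, j⟩, h⟩) (i' | ⟨⟨i', j'⟩, h'⟩) <;>
        simp [Fin.succ_ne_zero, (Fin.succ_ne_zero _).symm]
    · rintro ⟨⟨i, j⟩, h⟩
      induction j using Fin.cases with
      | zero => exact absurd h (Fin.not_lt_zero _)
      | succ j =>
        induction i using Fin.cases with
        | zero => exact ⟨Sum.inl j, rfl⟩
        | succ i => exact ⟨Sum.inr ⟨(i, j), Fin.succ_lt_succ_iff.1 h⟩, rfl⟩

theorem pairsEquiv_inl {l : ℕ} (j : Fin l) :
    (pairsEquiv l (Sum.inl j)).1 = (0, j.succ) := rfl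

theorem pairsEquiv_inr {l : ℕ} (p : Pairs l) :
    (pairsEquiv l (Sum.inr p)).1 = (p.1.1.succ, p.1.2.succ) := rfl

/-- Splitting off the first row of a rectangle. -/
def boxEquiv (l l' : ℕ) : Fin l' ⊕ Fin l × Fin l' ≃ Fin (l + 1) × Fin l' :=
  Equiv.ofBijective (Sum.elim (fun a => (0, a)) fun p => (p.1.succ, p.2)) <| by
    constructor
    · rintro (i | ⟨i, j⟩) (i' | ⟨i', j'⟩) <;>
        simp [Fin.succ_ne_zero, (Fin.succ_ne_zero _).symm]
    · rintro ⟨i, j⟩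
      induction i using Fin.cases with
      | zero => exact ⟨Sum.inl j, rfl⟩
      | succ i => exact ⟨Sum.inr (i, j), rfl⟩

theorem boxEquiv_inl {l l' : ℕ} (a : Fin l') : boxEquiv l l' (Sum.inl a) = (0, a) := rfl

theorem boxEquiv_inr {l l' : ℕ} (p : Fin l × Fin l') :
    boxEquiv l l' (Sum.inr p) = (p.1.succ, p.2) := rfl

/-- The exponents of the raising and lowering operators that involve the first row, split off. -/
def exponentsEquiv (l l' : ℕ) :
    ((Pairs l → ℕ) × (Pairs l' → ℕ) × (Fin l × Fin l' → ℕ)) × ((Fin l → ℕ) × (Fin l' → ℕ)) ≃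
      (Pairs (l + 1) → ℕ) × (Pairs l' → ℕ) × (Fin (l + 1) × Fin l' → ℕ) where
  toFun s := (Sum.elim s.2.1 s.1.1 ∘ (pairsEquiv l).symm, s.1.2.1,
    Sum.elim s.2.2 s.1.2.2 ∘ (boxEquiv l l').symm)
  invFun e := ((e.1 ∘ pairsEquiv l ∘ Sum.inr, e.2.1, e.2.2 ∘ boxEquiv l l' ∘ Sum.inr),
    (e.1 ∘ pairsEquiv l ∘ Sum.inl, e.2.2 ∘ boxEquiv l l' ∘ Sum.inl))
  left_inv s := by
    ext <;> simp
  right_inv e := by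
    refine Prod.ext ?_ (Prod.ext rfl ?_)
    · funext p
      obtain ⟨s, rfl⟩ := (pairsEquiv l).surjective p
      rcases s with s | s <;> simp
    · funext p
      obtain ⟨s, rfl⟩ := (boxEquiv l l').surjective p
      rcases s with s | s <;> simp

theorem raise_cons {l : ℕ} (k : Fin l → ℕ) (k₀ : Pairs l → ℕ) (n : ℤ) (α : Fin l → ℤ) :
    raise (Sum.elim k k₀ ∘ (pairsEquiv l).symm) (Fin.cons n α : Fin (l + 1) → ℤ) =
      Fin.cons (n + ∑ i, (k i : ℤ)) fun i => raise k₀ α i - k i := by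
  rw [raise, ← Equiv.sum_comp (pairsEquiv l), Fintype.sum_sum_type]
  funext i
  induction i using Fin.cases with
  | zero => simp [pairsEquiv_inl, pairsEquiv_inr, Finset.sum_apply, (Fin.succ_ne_zero _).symm]
  | succ i =>
    simp [pairsEquiv_inl, pairsEquiv_inr, Finset.sum_apply, Pi.single_apply, raise]
    ring

theorem lowerLeft_cons {l l' : ℕ} (d : Fin l' → ℕ) (d₀ : Fin l × Fin l' → ℕ) (n : ℤ)
    (α : Fin l → ℤ) :
    lowerLeft (Sum.elim d d₀ ∘ (boxEquiv l l').symm) (Fin.cons n α : Fin (l + 1) → ℤ) =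
      Fin.cons (n - ∑ a, (d a : ℤ)) (lowerLeft d₀ α) := by
  rw [lowerLeft, ← Equiv.sum_comp (boxEquiv l l'), Fintype.sum_sum_type]
  simp only [Function.comp_apply, Equiv.symm_apply_apply, Sum.elim_inl, Sum.elim_inr]
  funext i
  induction i using Fin.cases with
  | zero => simp [boxEquiv_inl, boxEquiv_inr, Finset.sum_apply, (Fin.succ_ne_zero _).symm]
  | succ i => simp [boxEquiv_inl, boxEquiv_inr, Finset.sum_apply, Pi.single_apply, lowerLeft]

theorem lowerRight_cons {l l' : ℕ} (d : Fin l' → ℕ) (d₀ : Fin l × Fin l' → ℕ) (β : Fin l' → ℤ) :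
    lowerRight (Sum.elim d d₀ ∘ (boxEquiv l l').symm) β = fun a => lowerRight d₀ β a - d a := by
  rw [lowerRight, ← Equiv.sum_comp (boxEquiv l l'), Fintype.sum_sum_type]
  simp only [Function.comp_apply, Equiv.symm_apply_apply, Sum.elim_inl, Sum.elim_inr]
  funext a
  simp [boxEquiv_inl, boxEquiv_inr, Finset.sum_apply, Pi.single_apply, lowerRight]
  ring

/-- The raising operator formula for arbitrary integer sequences. -/
def coupledQ {l l' : ℕ} (α : Fin l → ℤ) (β : Fin l' → ℤ) : A := ∑ᶠ e, term α β e

theorem term_cons {l l' : ℕ} (n : ℤ) (α : Fin l → ℤ) (β : Fin l' → ℤ)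
    (e : (Pairs l → ℕ) × (Pairs l' → ℕ) × (Fin l × Fin l' → ℕ))
    (s : (Fin l → ℕ) × (Fin l' → ℕ)) :
    term (Fin.cons n α : Fin (l + 1) → ℤ) β (exponentsEquiv l l' (e, s)) =
      ((∏ p, raiseCoeff (e.1 p)) * (∏ p, raiseCoeff (e.2.1 p)) * ∏ p, lowerCoeff (e.2.2 p)) •
        ((∏ i, raiseCoeff (s.1 i)) * ∏ a, lowerCoeff (s.2 a)) •
          (q x (n + ∑ i, (s.1 i : ℤ) - ∑ a, (s.2 a : ℤ)) *
            qPair (fun i => lowerLeft e.2.2 (raise e.1 α) i - s.1 i)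
              fun a => lowerRight e.2.2 (raise e.2.1 β) a - s.2 a) := by
  simp only [term, exponentsEquiv, Equiv.coe_fn_mk]
  rw [raise_cons, lowerLeft_cons, lowerRight_cons, smul_smul,
    ← Equiv.prod_comp (pairsEquiv l), ← Equiv.prod_comp (boxEquiv l l'), Fintype.prod_sum_type,
    Fintype.prod_sum_type]
  congr 1
  · simp only [Function.comp_apply, Equiv.symm_apply_apply, Sum.elim_inl, Sum.elim_inr]
    ring
  · rw [qPair, Fin.prod_univ_succ, qPair, mul_assoc]
    have h : (lowerLeft e.2.2 fun i => raise e.1 α i - (s.1 i : ℤ)) =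
        fun i => lowerLeft e.2.2 (raise e.1 α) i - (s.1 i : ℤ) := by
      funext i
      simp only [lowerLeft, Pi.sub_apply]
      ring
    simp only [Fin.cons_zero, Fin.cons_succ, h]

/-- The exponents split into those that involve the new row and the rest. The rest give `coupledQ α
β`; the former are exactly the sum by which the vertex operator acts on each product `qPair`. -/
theorem coupledQ_cons {l l' : ℕ} (n : ℤ) (α : Fin l → ℤ) (β : Fin l' → ℤ) :
    coupledQ (Fin.cons n α : Fin (l + 1) → ℤ) β = vertexOp n (coupledQ α β) := by
  rw [coupledQ, coupledQ, map_finsum _ (term_support_finite α β),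
    ← finsum_comp_equiv (exponentsEquiv l l'), finsum_curry]
  · refine finsum_congr fun e => ?_
    rw [term, map_smul, vertexOp_qPair_finsum, smul_finsum]
    exact finsum_congr fun s => term_cons n α β e s
  · exact (term_support_finite (Fin.cons n α : Fin (l + 1) → ℤ) β).preimage
      (exponentsEquiv l l').injective.injOn

end Prepend

/-! ### Pieri's formula for lists of parts -/

section Strips

/-- `listQ v (α₁, …, α_l)` is obtained from `v` by prepending the parts `α_l, …, α₁`. -/
def listQ (v : A) : List ℤ → A
  | [] => v
  | n :: α => vertexOp n (listQ v α)

/-- Weakly decreasing lists of nonnegative integers. -/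
def IsPart : List ℤ → Prop
  | [] => True
  | n :: α => α.headD 0 ≤ n ∧ IsPart α

/-- The sequences `(ν₂, ν₃, …)` for the partitions `ν` that interlace with a given one. -/
def strips : List ℤ → Finset (List ℤ)
  | [] => {[]}
  | n :: α => (strips α ×ˢ Finset.Icc (α.headD 0) n).image fun p => p.2 :: p.1

theorem sum_strips_cons {V : Type*} [AddCommMonoid V] (n : ℤ) (α : List ℤ) (F : List ℤ → V) :
    ∑ ρ ∈ strips (n :: α), F ρ =
      ∑ ρ ∈ strips α, ∑ c ∈ Finset.Icc (α.headD 0) n, F (c :: ρ) := by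
  rw [strips, Finset.sum_image, Finset.sum_product]
  rintro ⟨a, b⟩ _ ⟨c, d⟩ _ h
  simp only [List.cons.injEq] at h
  rw [h.1, h.2]

theorem mem_strips_cons {n : ℤ} {α ρ : List ℤ} :
    ρ ∈ strips (n :: α) ↔ ∃ c ρ', ρ = c :: ρ' ∧ α.headD 0 ≤ c ∧ c ≤ n ∧ ρ' ∈ strips α := by
  simp only [strips, Finset.mem_image, Finset.mem_product, Finset.mem_Icc, Prod.exists]
  constructor
  · rintro ⟨a, b, ⟨h1, h2, h3⟩, rfl⟩
    exact ⟨b, a, rfl, h2, h3, h1⟩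
  · rintro ⟨c, ρ', rfl, h1, h2, h3⟩
    exact ⟨ρ', c, ⟨h3, h1, h2⟩, rfl⟩

/-- Each part of `ρ` is at least the next part of `α`. Hence in degree `m < 0` the first part forced
by the total size is too small and every weight vanishes. -/
theorem sum_le_of_mem_strips {α ρ : List ℤ} (h : ρ ∈ strips α) :
    α.sum ≤ α.headD 0 + ρ.sum := by
  induction α generalizing ρ with
  | nil =>
    rw [strips, Finset.mem_singleton] at h
    simp [h]
  | cons n α ih =>
    obtain ⟨c, ρ', rfl, h1, h2, h3⟩ := mem_strips_cons.1 h
    have := ih h3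
    simp only [List.sum_cons, List.headD_cons]
    omega

/-- The factor of `ψ_{ν/α}` that is due to the first part of `α`, for `ν = (r, ρ)` with
`r > α₁`. -/
def headFactor : List ℤ → List ℤ → K
  | n :: α, c :: ρ =>
    if α.headD 0 < n then (if c < n then 1 - t else 1) else 1 - t + t * headFactor α ρ
  | _, _ => 1

/-- `ψ_{ν/α}` for `ν = (α₁, ρ)`. -/
def tailWeight : List ℤ → List ℤ → K
  | _ :: α, c :: ρ => if c < α.headD 0 then 0 else
      tailWeight α ρ * if c = α.headD 0 then 1 else headFactor α ρ
  | _, _ => 1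

/-- `ψ_{ν/α}` for `ν = (r, ρ)`, and `0` if `r < α₁`. -/
def stripWeight (α ρ : List ℤ) (r : ℤ) : K :=
  if r < α.headD 0 then 0 else tailWeight α ρ * if r = α.headD 0 then 1 else headFactor α ρ

theorem stripWeight_cons (n : ℤ) (α : List ℤ) (c : ℤ) (ρ : List ℤ) (r : ℤ) :
    stripWeight (n :: α) (c :: ρ) r = if r < n then 0 else stripWeight α ρ c *
      if r = n then 1 else
        if α.headD 0 < n then (if c < n then 1 - t else 1) else 1 - t + t * headFactor α ρ := rfl

/-- The inductive step of Pieri's formula for one fixed `ρ`. `S c` stands for `B_{n+r-c} B_c` on the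
vector of `ρ`, with `hS` the straightening rule; `w` and `u` are the weights before and after a part
`n` is prepended to `α`. The final bracket comes from `B_n H_m - t B_{n+1} H_{m-1}`. -/
theorem sum_strip_identity {k V : Type*} [Field k] [CharZero k] [AddCommGroup V] [Module k V]
    (t : k) (S : ℤ → V) (L n r : ℤ)
    (hLn : L ≤ n) (p g : k) (w : ℤ → k) (u : ℤ → ℤ → ℤ → k)
    (hw : ∀ c, w c = if c < L then 0 else p * if c = L then 1 else g)
    (hu : ∀ n c N, u n c N = if N < n then 0 else w c *
      if N = n then 1 else
        if L < n then (if c < n then 1 - t else 1) else 1 - t + t * g)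
    (hS : S r - t • S (r - 1) = t • S n - S (n + 1)) :
    ∑ c ∈ Finset.Icc L n, u n c (n + r - c) • S c =
      ∑ c ∈ Finset.Icc L (n + 1), u (n + 1) c (n + r - c) • S c +
        (w r • S r - t • w (r - 1) • S (r - 1)) := by
  have hsplit : Finset.Icc L (n + 1) = insert (n + 1) (Finset.Icc L n) := by
    ext c
    simp only [Finset.mem_insert, Finset.mem_Icc]
    omega
  rw [hsplit, Finset.sum_insert (by simp)]
  -- Generically both weights are `(1 - t) * w c` or both are zero; they can differ only at `c = r`,
  -- `c = r - 1` and `c = n`.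
  have hδ : ∀ c ∈ Finset.Icc L n, u n c (n + r - c) - u (n + 1) c (n + r - c) =
      (if c = r then w c else 0) - (if c = r - 1 then t * w c else 0) +
        if c = n then (if n < r then t * (p * g) else 0) else 0 := by
    intro c hc
    rw [Finset.mem_Icc] at hc
    have hwn : c = n → p * g = w c * if L < n then 1 else g := by
      intro h
      rw [hw, if_neg (by omega)]
      split_ifs <;> first | omega | ring1
    simp only [hu]
    split_ifs at hwn ⊢ <;> first | omega | ring1 | (rw [hwn ‹_›]; ring1)
  have hlast : u (n + 1) (n + 1) (n + r - (n + 1)) = if n + 1 < r then p * g else 0 := by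
    simp only [hu, hw]
    split_ifs <;> first | omega | ring1
  have hsum : ∑ c ∈ Finset.Icc L n, u n c (n + r - c) • S c -
      ∑ c ∈ Finset.Icc L n, u (n + 1) c (n + r - c) • S c =
      (if L ≤ r ∧ r ≤ n then w r • S r else 0) -
        (if L ≤ r - 1 ∧ r - 1 ≤ n then (t * w (r - 1)) • S (r - 1) else 0) +
        if n < r then (t * (p * g)) • S n else 0 := by
    rw [← Finset.sum_sub_distrib, Finset.sum_congr rfl fun c hc => by rw [← sub_smul, hδ c hc]]
    simp only [add_smul, sub_smul, ite_smul, zero_smul, Finset.sum_add_distrib,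
      Finset.sum_sub_distrib, Finset.sum_ite_eq', Finset.mem_Icc]
    rw [if_pos (c := L ≤ n ∧ n ≤ n) ⟨hLn, le_rfl⟩]
  rw [sub_eq_iff_eq_add] at hsum
  rw [hsum, hlast]
  rcases lt_trichotomy r (n + 1) with h | h | h
  · have h1 : (if L ≤ r ∧ r ≤ n then w r • S r else 0) = w r • S r := by
      rw [hw]
      split_ifs <;> first | omega | simp
    have h2 : (if L ≤ r - 1 ∧ r - 1 ≤ n then (t * w (r - 1)) • S (r - 1) else 0) =
        (t * w (r - 1)) • S (r - 1) := by
      rw [hw]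
      split_ifs <;> first | omega | simp
    rw [h1, h2, if_neg (by omega), if_neg (by omega), smul_smul]
    module
  · subst h
    rw [add_sub_cancel_right] at hS ⊢
    -- For `r = n + 1` the straightening rule reads `2 S(n + 1) = 2t S(n)`.
    have hS' : S (n + 1) = t • S n := by
      have h2 : (2 : k) • S (n + 1) = (2 : k) • t • S n := by
        rw [two_smul, two_smul]
        linear_combination (norm := module) hS
      have := congrArg (fun v => (2 : k)⁻¹ • v) h2
      simpa only [smul_smul, inv_mul_cancel₀ (two_ne_zero (α := k)), one_mul, one_smul,
        ← mul_assoc] using this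
    have hw1 : w (n + 1) = p * g := by
      rw [hw, if_neg (by omega), if_neg (by omega)]
    rw [if_neg (by omega), if_pos ⟨hLn, le_rfl⟩, if_pos (by omega), if_neg (by omega), hw1, hS']
    module
  · have hw1 : w r = p * g := by
      rw [hw, if_neg (by omega), if_neg (by omega)]
    have hw2 : w (r - 1) = p * g := by
      rw [hw, if_neg (by omega), if_neg (by omega)]
    rw [if_neg (by omega), if_neg (by omega), if_pos (by omega), if_pos (by omega), hw1, hw2]
    linear_combination (norm := module) (-(p * g)) • hS

/-- Pieri's formula for the vectors generated from a vector that does not involve the `xₙ`. -/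
theorem q_xOp_listQ (v : A) (hv : ∀ n, vertexOp n v = q xOp n v) (α : List ℤ) (hα : IsPart α)
    (m : ℤ) :
    q xOp m (listQ v α) = ∑ ρ ∈ strips α,
      stripWeight α ρ (m + α.sum - ρ.sum) • listQ v ((m + α.sum - ρ.sum) :: ρ) := by
  induction α generalizing m with
  | nil =>
    simp only [strips, Finset.sum_singleton, listQ, hv, List.sum_nil, add_zero, sub_zero,
      stripWeight, List.headD_nil, tailWeight, headFactor, ite_self, mul_one]
    split_ifs with h
    · rw [q_of_neg _ h]
      simp
    · rw [one_smul]
  | cons n α ih =>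
    obtain ⟨hn, hα⟩ := hα
    -- The recursion passes from `(m, n)` to `(m - 1, n + 1)`, so `n` must vary during the induction
    -- on a bound for `m`.
    suffices H : ∀ (k : ℕ) (m : ℤ), m < k → ∀ n, α.headD 0 ≤ n →
        q xOp m (listQ v (n :: α)) = ∑ ρ ∈ strips α, ∑ c ∈ Finset.Icc (α.headD 0) n,
          stripWeight (n :: α) (c :: ρ) (n + (m + α.sum - ρ.sum) - c) •
            vertexOp (n + (m + α.sum - ρ.sum) - c) (vertexOp c (listQ v ρ)) by
      rw [H (m.toNat + 1) m (by omega) n hn, sum_strips_cons]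
      refine Finset.sum_congr rfl fun ρ _ => Finset.sum_congr rfl fun c _ => ?_
      have : m + (n :: α).sum - (c :: ρ).sum = n + (m + α.sum - ρ.sum) - c := by
        simp only [List.sum_cons]
        ring
      rw [this]
      rfl
    intro k
    induction k with
    | zero =>
      intro m hm n _
      rw [q_of_neg _ (by exact_mod_cast hm), LinearMap.zero_apply]
      symm
      refine Finset.sum_eq_zero fun ρ hρ => Finset.sum_eq_zero fun c hc => ?_
      have := sum_le_of_mem_strips hρ
      rw [Finset.mem_Icc] at hc
      rw [stripWeight_cons, if_pos (by push_cast at hm; omega), zero_smul]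
    | succ k ihk =>
      intro m hm n hn
      have h1 := vertexOp_q_xOp n m (listQ v α)
      have h2 := ihk (m - 1) (by push_cast at hm; omega) (n + 1) (by omega)
      rw [listQ] at h2
      rw [listQ, sub_eq_iff_eq_add.1 h1.symm, h2, ih hα, ih hα]
      simp only [map_sum, Finset.smul_sum]
      rw [← Finset.sum_sub_distrib, ← Finset.sum_add_distrib]
      refine Finset.sum_congr rfl fun ρ _ => ?_
      have h3 := sum_strip_identity t
        (fun c => vertexOp (n + (m + α.sum - ρ.sum) - c) (vertexOp c (listQ v ρ)))
        (α.headD 0) n (m + α.sum - ρ.sum) hn (tailWeight α ρ) (headFactor α ρ)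
        (stripWeight α ρ) (fun n c => stripWeight (n :: α) (c :: ρ)) (fun _ => rfl)
        (fun _ _ _ => rfl) (by
          have := vertexOp_vertexOp n (m + α.sum - ρ.sum) (listQ v ρ)
          ring_nf at this ⊢
          exact this)
      rw [h3, add_comm]
      have e1 : n + 1 + (m + α.sum - ρ.sum - 1) = n + (m + α.sum - ρ.sum) := by ring
      have e2 : m - 1 + α.sum - ρ.sum = m + α.sum - ρ.sum - 1 := by ring
      have e3 : n + (m + α.sum - ρ.sum) - (m + α.sum - ρ.sum - 1) = n + 1 := by ring
      simp only [e1, e2, e3, add_sub_cancel_right, map_smul, listQ]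

end Strips

/-! ### The recursive weights as products over multiplicities -/

section Weights

theorem le_headD_of_mem {α : List ℤ} (hα : IsPart α) {a : ℤ} (ha : a ∈ α) : a ≤ α.headD 0 := by
  induction α with
  | nil => simp at ha
  | cons n α ih =>
    rcases List.mem_cons.1 ha with rfl | h
    · exact le_rfl
    · exact (ih hα.2 h).trans hα.1

theorem le_headD_of_mem_strips {α ρ : List ℤ} (hα : IsPart α) (hρ : ρ ∈ strips α) {a : ℤ}
    (ha : a ∈ ρ) : a ≤ α.headD 0 := by
  induction α generalizing ρ with
  | nil =>
    rw [strips, Finset.mem_singleton] at hρ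
    simp [hρ] at ha
  | cons n α ih =>
    obtain ⟨c, ρ, rfl, h1, h2, h3⟩ := mem_strips_cons.1 hρ
    rcases List.mem_cons.1 ha with rfl | h
    · exact h2
    · exact (ih hα.2 h3 h).trans hα.1

/-- Two consecutive equal parts of `α` squeeze the part of `ρ` between them to the same value, so at
most one copy is lost. -/
theorem count_headD_le {α ρ : List ℤ} (hα : IsPart α) (hρ : ρ ∈ strips α) :
    α.count (α.headD 0) ≤ ρ.count (α.headD 0) + 1 := by
  induction α generalizing ρ with
  | nil => simp
  | cons n α ih =>
    obtain ⟨c, ρ, rfl, h1, h2, h3⟩ := mem_strips_cons.1 hρ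
    rw [List.headD_cons, List.count_cons_self]
    rcases hα.1.lt_or_eq with h | h
    · rw [List.count_eq_zero_of_not_mem fun h' => absurd (le_headD_of_mem hα.2 h') (by omega)]
      omega
    · have := ih hα.2 h3
      rw [h] at this
      obtain rfl : c = n := by omega
      rw [List.count_cons_self]
      omega

theorem count_le_count_of_mem_strips_cons {n : ℤ} {α ρ : List ℤ} (hα : IsPart (n :: α))
    (hρ : ρ ∈ strips (n :: α)) : α.count n ≤ ρ.count n := by
  obtain ⟨c, ρ, rfl, h1, h2, h3⟩ := mem_strips_cons.1 hρ
  rcases hα.1.lt_or_eq with h | h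
  · rw [List.count_eq_zero_of_not_mem fun h' => absurd (le_headD_of_mem hα.2 h') (by omega)]
    omega
  · have := count_headD_le hα.2 h3
    rw [h] at this
    obtain rfl : c = n := by omega
    rwa [List.count_cons_self]

/-- The factor of `ψ_{ν/α}` at `j`. -/
def psiFactor (ν α : List ℤ) (j : ℤ) : K :=
  if 0 < j ∧ ν.count j < α.count j then 1 - t ^ α.count j else 1

/-- `ψ_{ν/α}` in terms of the multiplicities of the parts. -/
def listPsi (ν α : List ℤ) : K := ∏ j ∈ α.toFinset, psiFactor ν α j

theorem listPsi_eq_prod (ν α : List ℤ) (s : Finset ℤ) (hs : ∀ j ∈ α, 0 < j → j ∈ s) :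
    listPsi ν α = ∏ j ∈ s, psiFactor ν α j := by
  have h1 : ∀ j, ¬ (j ∈ α ∧ 0 < j) → psiFactor ν α j = 1 := by
    intro j hj
    refine if_neg fun h => hj ⟨?_, h.1⟩
    exact List.count_pos_iff.1 (by omega)
  have h2 : ∏ j ∈ α.toFinset ∩ s, psiFactor ν α j = ∏ j ∈ s, psiFactor ν α j :=
    Finset.prod_subset Finset.inter_subset_right fun j hj hj' =>
      h1 j fun h => hj' (Finset.mem_inter.2 ⟨List.mem_toFinset.2 h.1, hj⟩)
  rw [← h2]
  exact (Finset.prod_subset Finset.inter_subset_left fun j hj hj' =>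
    h1 j fun h => hj' (Finset.mem_inter.2 ⟨hj, hs j h.1 h.2⟩)).symm

/-- Each further copy of the largest part uses `1 - t + t(1 - tᵐ) = 1 - tᵐ⁺¹`, or `1 - t + t = 1`
when no copy is lost. -/
theorem headFactor_eq {α ρ : List ℤ} (hα : IsPart α) (hρ : ρ ∈ strips α) :
    headFactor α ρ = psiFactor ρ α (α.headD 0) := by
  induction α generalizing ρ with
  | nil => simp [headFactor, psiFactor]
  | cons n α ih =>
    obtain ⟨c, ρ, rfl, h1, h2, h3⟩ := mem_strips_cons.1 hρ
    have hnn : 0 ≤ α.headD 0 := by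
      have : ∀ β : List ℤ, IsPart β → 0 ≤ β.headD 0 := by
        intro β hβ
        induction β with
        | nil => exact le_rfl
        | cons b β ihβ => exact (ihβ hβ.2).trans hβ.1
      exact this α hα.2
    rw [headFactor, psiFactor, List.headD_cons, List.count_cons_self]
    rcases hα.1.lt_or_eq with h | h
    · rw [if_pos h, List.count_eq_zero_of_not_mem
        fun h' => absurd (le_headD_of_mem hα.2 h') (by omega), List.count_cons,
        List.count_eq_zero_of_not_mem
        fun h' => absurd (le_headD_of_mem_strips hα.2 h3 h') (by omega)]
      by_cases hc : c = n
      · simp [hc]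
      · have : c < n := by omega
        have h0 : 0 < n := by omega
        simp [hc, this, h0]
    · obtain rfl : c = n := by omega
      rw [if_neg (by omega), ih hα.2 h3, h, psiFactor, List.count_cons_self]
      simp only [Nat.add_lt_add_iff_right]
      split_ifs
      · ring
      · ring

/-- Only the factor at `n` can change. It is trivial on `α`, and also for `r = n`, by
`count_le_count_of_mem_strips_cons`; a larger `r` is not a part of `n :: α`. -/
theorem listPsi_cons {n r : ℤ} {α ρ : List ℤ} (hα : IsPart (n :: α)) (hρ : ρ ∈ strips (n :: α))
    (hr : n ≤ r) :
    listPsi (r :: ρ) (n :: α) =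
      listPsi ρ α * if r = n then 1 else headFactor (n :: α) ρ := by
  have hc := count_le_count_of_mem_strips_cons hα hρ
  rw [listPsi_eq_prod _ (n :: α) (insert n α.toFinset) (by simp +contextual),
    listPsi_eq_prod _ α (insert n α.toFinset) (by simp +contextual),
    ← Finset.mul_prod_erase _ _ (Finset.mem_insert_self n _),
    ← Finset.mul_prod_erase _ (psiFactor ρ α) (Finset.mem_insert_self n _), mul_comm _ (ite _ _ _),
    ← mul_assoc]
  congr 1
  · rw [headFactor_eq hα hρ, List.headD_cons]
    simp only [psiFactor, List.count_cons, beq_self_eq_true, if_true, beq_iff_eq]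
    by_cases h : r = n
    · simp [h, not_lt.2 hc]
    · simp [h, not_lt.2 hc]
  · refine Finset.prod_congr rfl fun j hj => ?_
    have hj' : j ≠ n := (Finset.mem_erase.1 hj).1
    by_cases hjr : j = r
    · have h1 : α.count r = 0 := List.count_eq_zero_of_not_mem fun h' =>
        absurd ((le_headD_of_mem hα.2 h').trans hα.1) (by omega)
      subst hjr
      simp [psiFactor, h1, hj'.symm]
    · simp [psiFactor, hj'.symm, Ne.symm hjr]

theorem listPsi_eq_stripWeight {α ρ : List ℤ} (hα : IsPart α) (hρ : ρ ∈ strips α) {r : ℤ}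
    (hr : α.headD 0 ≤ r) : listPsi (r :: ρ) α = stripWeight α ρ r := by
  induction α generalizing ρ r with
  | nil =>
    rw [stripWeight, if_neg (not_lt.2 hr)]
    simp [listPsi, tailWeight, headFactor]
  | cons n α ih =>
    rw [listPsi_cons hα hρ hr]
    obtain ⟨c, ρ, rfl, h1, h2, h3⟩ := mem_strips_cons.1 hρ
    rw [ih hα.2 h3 h1, stripWeight_cons, if_neg (show ¬ r < n from not_lt.2 hr)]
    rfl

end Weights

/-! ### Row lengths as lists; trailing zeros -/

section RowLists

/-- The list `(f 0, …, f (k - 1))`. -/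
def rowList (f : ℕ → ℕ) (k : ℕ) : List ℤ := (List.range k).map fun i => (f i : ℤ)

theorem rowList_zero (f : ℕ → ℕ) : rowList f 0 = [] := rfl

theorem rowList_succ (f : ℕ → ℕ) (k : ℕ) :
    rowList f (k + 1) = (f 0 : ℤ) :: rowList (fun i => f (i + 1)) k := by
  simp [rowList, List.range_succ_eq_map, Function.comp_def]

theorem headD_rowList (f : ℕ → ℕ) (k : ℕ) (hk : f k = 0) :
    (rowList f k).headD 0 = f 0 := by
  rcases k with _ | k
  · simp [rowList_zero, hk]
  · rw [rowList_succ, List.headD_cons]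

theorem isPart_rowList (f : ℕ → ℕ) (hf : Antitone f) (k : ℕ) (hk : f k = 0) :
    IsPart (rowList f k) := by
  induction k generalizing f with
  | zero => trivial
  | succ k ih =>
    rw [rowList_succ]
    refine ⟨?_, ih _ (fun i j h => hf (by omega)) hk⟩
    rw [headD_rowList _ k hk]
    exact_mod_cast hf (Nat.zero_le 1)

theorem rowList_mem_strips_iff (f g : ℕ → ℕ) (k : ℕ) (hk : f k = 0) :
    rowList g k ∈ strips (rowList f k) ↔ ∀ i < k, f (i + 1) ≤ g i ∧ g i ≤ f i := by
  induction k generalizing f g with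
  | zero => simp [rowList_zero, strips]
  | succ k ih =>
    rw [rowList_succ, rowList_succ, mem_strips_cons, headD_rowList _ k hk]
    constructor
    · rintro ⟨c, ρ', h, h1, h2, h3⟩
      obtain ⟨rfl, rfl⟩ := List.cons.inj h
      intro i hi
      rcases i with _ | i
      · exact ⟨by exact_mod_cast h1, by exact_mod_cast h2⟩
      · exact (ih _ _ hk).1 h3 i (by omega)
    · intro h
      exact ⟨_, _, rfl, by exact_mod_cast (h 0 (by omega)).1, by exact_mod_cast (h 0 (by omega)).2,
        (ih _ _ hk).2 fun i hi => h (i + 1) (by omega)⟩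

theorem exists_rowList_of_mem_strips (f : ℕ → ℕ) (k : ℕ) (hk : f k = 0) {ρ : List ℤ}
    (hρ : ρ ∈ strips (rowList f k)) : ∃ g : ℕ → ℕ, (∀ i, k ≤ i → g i = 0) ∧ ρ = rowList g k := by
  induction k generalizing f ρ with
  | zero =>
    rw [rowList_zero, strips, Finset.mem_singleton] at hρ
    exact ⟨fun _ => 0, fun _ _ => rfl, hρ⟩
  | succ k ih =>
    rw [rowList_succ] at hρ
    obtain ⟨c, ρ', rfl, h1, h2, h3⟩ := mem_strips_cons.1 hρ
    obtain ⟨g, hg, rfl⟩ := ih _ hk h3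
    rw [headD_rowList _ k hk] at h1
    refine ⟨fun i => Nat.casesOn i c.toNat g, ?_, ?_⟩
    · rintro (_ | i) hi
      · omega
      · exact hg i (by omega)
    · rw [rowList_succ]
      exact congrArg (· :: rowList g k) (Int.toNat_of_nonneg (by omega : 0 ≤ c)).symm

theorem rowList_injOn {f g : ℕ → ℕ} {k : ℕ} (h : rowList f k = rowList g k) :
    ∀ i < k, f i = g i := by
  intro i hi
  have := List.map_inj_left.1 h i (List.mem_range.2 hi)
  exact_mod_cast this

theorem sum_rowList (f : ℕ → ℕ) (k : ℕ) :
    (rowList f k).sum = ((∑ i ∈ Finset.range k, f i : ℕ) : ℤ) := by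
  induction k generalizing f with
  | zero => simp [rowList_zero]
  | succ k ih =>
    rw [rowList_succ, List.sum_cons, ih, Finset.sum_range_succ']
    push_cast
    ring

theorem rowList_add (f : ℕ → ℕ) (k j : ℕ) (h : ∀ i, k ≤ i → f i = 0) :
    rowList f (k + j) = rowList f k ++ List.replicate j 0 := by
  rw [rowList, List.range_add, List.map_append, List.map_map]
  congr 1
  refine List.eq_replicate_iff.2 ⟨by simp, ?_⟩
  intro b hb
  obtain ⟨i, _, rfl⟩ := List.mem_map.1 hb
  simp [h (k + i) (by omega)]

/-- On `v` the operator `B_0` is `H_0 = 1`. This allows every `ν` interlacing with `λ` to be listed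
with one row more than `λ`, whatever its true length. -/
theorem listQ_append_replicate (v : A) (hv : ∀ n, vertexOp n v = q xOp n v) (α : List ℤ) (j : ℕ) :
    listQ v (α ++ List.replicate j 0) = listQ v α := by
  induction α with
  | nil =>
    induction j with
    | zero => rfl
    | succ j ih =>
      rw [List.replicate_succ]
      rw [List.nil_append] at ih ⊢
      change vertexOp 0 (listQ v (List.replicate j 0)) = v
      rw [ih]
      change vertexOp 0 v = v
      rw [hv, q_zero]
      rfl
  | cons n α ih => rw [List.cons_append, listQ, listQ, ih]

end RowLists

/-! ### Young diagrams, their multiplicities and `ψ` -/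

section YoungDiagrams

theorem rowLen_le_iff (ν : YoungDiagram) (i j : ℕ) : ν.rowLen i ≤ j ↔ ν.colLen j ≤ i := by
  rw [← not_lt, ← not_lt, ← YoungDiagram.mem_iff_lt_rowLen, ← YoungDiagram.mem_iff_lt_colLen]

theorem rowLen_eq_zero (ν : YoungDiagram) {i : ℕ} (h : ν.colLen 0 ≤ i) : ν.rowLen i = 0 :=
  Nat.le_zero.1 ((rowLen_le_iff ν i 0).2 h)

theorem antitone_rowLen (ν : YoungDiagram) : Antitone ν.rowLen :=
  fun i j h => ν.rowLen_anti i j h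

theorem youngDiagram_ext {ν ν' : YoungDiagram} (h : ∀ i, ν.rowLen i = ν'.rowLen i) : ν = ν' := by
  refine SetLike.ext fun p => ?_
  obtain ⟨i, j⟩ := p
  rw [YoungDiagram.mem_iff_lt_rowLen, YoungDiagram.mem_iff_lt_rowLen, h]

theorem exists_youngDiagram (f : ℕ → ℕ) (hf : Antitone f) (k : ℕ) (hk : f k = 0) :
    ∃ ν : YoungDiagram, ∀ i, ν.rowLen i = f i := by
  let ν : YoungDiagram :=
    { cells := {p ∈ Finset.range k ×ˢ Finset.range (f 0) | p.2 < f p.1}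
      isLowerSet := by
        rintro ⟨i, j⟩ ⟨i', j'⟩ ⟨hi, hj⟩ h
        simp only [Finset.coe_filter, Finset.mem_product, Finset.mem_range,
          Set.mem_ofPred_eq] at h hi hj ⊢
        have := hf hi
        omega }
  refine ⟨ν, fun i => eq_of_forall_lt_iff fun j => ?_⟩
  rw [← YoungDiagram.mem_iff_lt_rowLen, ← YoungDiagram.mem_cells]
  simp only [ν, Finset.mem_filter, Finset.mem_product, Finset.mem_range]
  refine ⟨fun h => h.2, fun h => ⟨⟨?_, ?_⟩, h⟩⟩
  · by_contra hi
    have := hf (not_lt.1 hi)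
    omega
  · have := hf (Nat.zero_le i)
    omega

theorem card_eq_sum_rowLen (ν : YoungDiagram) {k : ℕ} (hk : ν.colLen 0 ≤ k) :
    ν.card = ∑ i ∈ Finset.range k, ν.rowLen i := by
  rw [YoungDiagram.card, Finset.card_eq_sum_card_fiberwise (f := Prod.fst) (t := Finset.range k)]
  · refine Finset.sum_congr rfl fun i _ => ?_
    rw [YoungDiagram.rowLen_eq_card]
    rfl
  · rintro ⟨i, j⟩ h
    have h1 : i < ν.colLen j := YoungDiagram.mem_iff_lt_colLen.1 h
    have h2 := ν.colLen_anti 0 j (Nat.zero_le j)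
    simp only [Finset.coe_range, Set.mem_Iio]
    omega

/-- The rows of length `j` are those with index from `colLen j` up to, but excluding, `colLen (j -
1)`. Thus `θ'_j - θ'_{j+1} = m_j(ν) - m_j(λ)`. -/
theorem count_rowLens_add_colLen (ν : YoungDiagram) {j : ℕ} (hj : 1 ≤ j) :
    ν.rowLens.count j + ν.colLen j = ν.colLen (j - 1) := by
  have h : ν.rowLens.count j = (Finset.Ico (ν.colLen j) (ν.colLen (j - 1))).card := by
    rw [YoungDiagram.rowLens, List.count, List.countP_map, List.countP_eq_length_filter]
    rw [← List.toFinset_card_of_nodup ((List.nodup_range).filter _)]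
    congr 1
    ext i
    have h1 := rowLen_le_iff ν i j
    have h2 := rowLen_le_iff ν i (j - 1)
    have h3 := ν.colLen_anti 0 (j - 1) (Nat.zero_le _)
    simp only [List.mem_toFinset, List.mem_filter, List.mem_range, Function.comp_apply,
      beq_iff_eq, Finset.mem_Ico]
    omega
  have := ν.colLen_anti (j - 1) j (Nat.sub_le _ _)
  rw [h, Nat.card_Ico]
  omega

theorem rowList_rowLen (ν : YoungDiagram) :
    rowList ν.rowLen (ν.colLen 0) = List.map (Nat.cast : ℕ → ℤ) ν.rowLens := by
  rw [rowList, YoungDiagram.rowLens, List.map_map]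
  rfl

theorem count_rowList_rowLen (ν : YoungDiagram) {k : ℕ} (hk : ν.colLen 0 ≤ k) {j : ℕ}
    (hj : 1 ≤ j) : (rowList ν.rowLen k).count (j : ℤ) = ν.rowLens.count j := by
  obtain ⟨i, rfl⟩ := Nat.exists_eq_add_of_le hk
  rw [rowList_add _ _ _ fun i hi => rowLen_eq_zero ν hi, List.count_append, rowList_rowLen,
    List.count_map_of_injective _ _ Nat.cast_injective, List.count_replicate]
  have : ¬ (0 : ℤ) = j := by omega
  simp [this]

theorem colLen_le_of_interlaces {ν lam : YoungDiagram} (h : Interlaces ν lam) :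
    ν.colLen 0 ≤ lam.colLen 0 + 1 := by
  rw [← rowLen_le_iff]
  have := (h (lam.colLen 0)).2
  rw [rowLen_eq_zero lam le_rfl] at this
  exact this

theorem psi_eq_listPsi {ν lam : YoungDiagram} (h : Interlaces ν lam) :
    psi ν lam = listPsi (rowList ν.rowLen (lam.colLen 0 + 1))
      (rowList lam.rowLen (lam.colLen 0)) := by
  rw [listPsi_eq_prod _ _ ((Finset.Icc 1 (ν.rowLen 0)).map Nat.castEmbedding), Finset.prod_map,
    psi, J, Finset.prod_filter]
  · refine Finset.prod_congr rfl fun j hj => ?_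
    have hj1 := (Finset.mem_Icc.1 hj).1
    have h1 := count_rowLens_add_colLen ν hj1
    have h2 := count_rowLens_add_colLen lam hj1
    rw [psiFactor, Nat.castEmbedding_apply,
      count_rowList_rowLen ν (colLen_le_of_interlaces h) hj1,
      count_rowList_rowLen lam le_rfl hj1]
    have : skewCol ν lam j < skewCol ν lam (j + 1) ↔
        0 < (j : ℤ) ∧ ν.rowLens.count j < lam.rowLens.count j := by
      rw [skewCol, skewCol, Nat.add_sub_cancel]
      omega
    simp only [this]
  · intro j hj h0
    obtain ⟨i, _, rfl⟩ := List.mem_map.1 hj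
    refine Finset.mem_map.2 ⟨lam.rowLen i, ?_, rfl⟩
    have h1 := lam.rowLen_anti 0 i (Nat.zero_le i)
    have h2 := (h 0).1
    rw [Finset.mem_Icc]
    omega

end YoungDiagrams

/-! ### `Q` as iterated vertex operators on `Q_{[∅,μ]}` -/

section Vacuum

theorem shift_coupledQ_zero {l' : ℕ} (α : Fin 0 → ℤ) (β : Fin l' → ℤ) :
    shift (xWeight raiseWeight) (coupledQ α β) = Polynomial.C (coupledQ α β) := by
  rw [coupledQ, map_finsum _ (term_support_finite α β), map_finsum _ (term_support_finite α β)]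
  refine finsum_congr fun e => ?_
  rw [term, map_smul, ← Polynomial.smul_C]
  congr 1
  rw [qPair, Finset.univ_eq_empty, Finset.prod_empty, one_mul, map_prod, map_prod]
  exact Finset.prod_congr rfl fun i _ => shift_q_of_eq_zero Sum.inr _ (fun _ => rfl) _

theorem vertexOp_coupledQ_zero {l' : ℕ} (α : Fin 0 → ℤ) (β : Fin l' → ℤ) (n : ℤ) :
    vertexOp n (coupledQ α β) = q xOp n (coupledQ α β) := by
  have h := lsum_C_mul_X_pow (fun k => q xOp (n + k)) (coupledQ α β) 0
  rw [pow_zero, mul_one, Nat.cast_zero, add_zero] at h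
  rw [vertexOp, LinearMap.comp_apply, AlgHom.toLinearMap_apply, shift_coupledQ_zero, h]

theorem coupledQ_eq_listQ {l l' : ℕ} (f : ℕ → ℕ) (β : Fin l' → ℤ) :
    coupledQ (fun i : Fin l => (f i : ℤ)) β =
      listQ (coupledQ (fun i : Fin 0 => i.elim0) β) (rowList f l) := by
  induction l generalizing f with
  | zero =>
    rw [rowList_zero, listQ]
    congr 1
    exact Subsingleton.elim _ _
  | succ l ih =>
    rw [rowList_succ, listQ, ← ih, ← coupledQ_cons]
    congr 1
    funext i
    induction i using Fin.cases with
    | zero => rfl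
    | succ i => simp

/-- The function `Q_{[∅,μ]}`. -/
def vacuum (mu : YoungDiagram) : A := coupledQ (fun i : Fin 0 => i.elim0) (rows mu)

theorem vertexOp_vacuum (mu : YoungDiagram) (n : ℤ) :
    vertexOp n (vacuum mu) = q xOp n (vacuum mu) :=
  vertexOp_coupledQ_zero _ _ n

theorem Q_eq_listQ (lam mu : YoungDiagram) {k : ℕ} (hk : lam.colLen 0 ≤ k) :
    Q lam mu = listQ (vacuum mu) (rowList lam.rowLen k) := by
  obtain ⟨j, rfl⟩ := Nat.exists_eq_add_of_le hk
  rw [rowList_add _ _ _ fun i hi => rowLen_eq_zero lam hi,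
    listQ_append_replicate _ (vertexOp_vacuum mu)]
  exact coupledQ_eq_listQ lam.rowLen (rows mu)

end Vacuum

/-! ### Pieri's formula for Young diagrams -/

section Pieri

theorem card_le_of_interlaces {ν lam : YoungDiagram} (h : Interlaces ν lam) :
    lam.card ≤ ν.card := by
  rw [card_eq_sum_rowLen lam (Nat.le_succ (lam.colLen 0)),
    card_eq_sum_rowLen ν (colLen_le_of_interlaces h)]
  exact Finset.sum_le_sum fun i _ => (h i).1

theorem coeff_scale (p : Polynomial K) (f : A) (n : ℕ) :
    PowerSeries.coeff n (scale p f) = p.coeff n • f := by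
  rw [scale, PowerSeries.coeff_mul_C, Polynomial.coeff_coe, Polynomial.coeff_map,
    Algebra.smul_def]

theorem coeff_scale_P {ν lam : YoungDiagram} (h : Interlaces ν lam) (f : A) (n : ℕ) :
    PowerSeries.coeff n (scale (P ν lam) f) =
      if ν.card = lam.card + n then psi ν lam • f else 0 := by
  rw [coeff_scale, P, if_pos h, Polynomial.coeff_monomial, ite_smul, zero_smul]
  have := card_le_of_interlaces h
  refine if_congr ?_ rfl rfl
  omega

theorem coeff_act_Gamma1 (f : A) (n : ℕ) :
    PowerSeries.coeff n (act Gamma1 f) = q xOp n f := by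
  rw [act, PowerSeries.coeff_mk, q_natCast, Gamma1]

/-- The rows of `ν` below the first one, for `ν` interlacing with `lam`. -/
def tailList (lam ν : YoungDiagram) : List ℤ :=
  rowList (fun i => ν.rowLen (i + 1)) (lam.colLen 0)

theorem tailList_mem_strips {ν lam : YoungDiagram} (h : Interlaces ν lam) :
    tailList lam ν ∈ strips (rowList lam.rowLen (lam.colLen 0)) :=
  (rowList_mem_strips_iff _ _ _ (rowLen_eq_zero lam le_rfl)).2
    fun i _ => ⟨(h (i + 1)).1, (h i).2⟩

theorem rowLen_zero_eq {ν lam : YoungDiagram} (h : Interlaces ν lam) {n : ℕ}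
    (hn : ν.card = lam.card + n) :
    (ν.rowLen 0 : ℤ) =
      n + (rowList lam.rowLen (lam.colLen 0)).sum - (tailList lam ν).sum := by
  rw [tailList, sum_rowList, sum_rowList, ← card_eq_sum_rowLen lam le_rfl]
  have := card_eq_sum_rowLen ν (colLen_le_of_interlaces h)
  rw [Finset.sum_range_succ'] at this
  omega

/-- The size recovers the first row, and interlacing leaves no rows beyond the listed ones. In each
degree the sum over `ν` thus becomes a sum over `strips`. -/
theorem eq_of_tailList_eq {ν ν' lam : YoungDiagram} (h : Interlaces ν lam)
    (h' : Interlaces ν' lam) (hcard : ν.card = ν'.card)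
    (ht : tailList lam ν = tailList lam ν') : ν = ν' := by
  have hc := card_le_of_interlaces h
  have h0 : ν.rowLen 0 = ν'.rowLen 0 := by
    have h1 := rowLen_zero_eq h (n := ν.card - lam.card) (by omega)
    have h2 := rowLen_zero_eq h' (n := ν.card - lam.card) (by omega)
    rw [ht] at h1
    omega
  refine youngDiagram_ext fun i => ?_
  rcases i with _ | i
  · exact h0
  · by_cases hi : i < lam.colLen 0
    · exact rowList_injOn ht i hi
    · have h1 := colLen_le_of_interlaces h
      have h2 := colLen_le_of_interlaces h'
      rw [rowLen_eq_zero ν (by omega), rowLen_eq_zero ν' (by omega)]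

theorem exists_interlaces_of_mem_strips {lam : YoungDiagram} {ρ : List ℤ}
    (hρ : ρ ∈ strips (rowList lam.rowLen (lam.colLen 0))) {n : ℕ}
    (hr : (lam.rowLen 0 : ℤ) ≤ n + (rowList lam.rowLen (lam.colLen 0)).sum - ρ.sum) :
    ∃ ν, Interlaces ν lam ∧ ν.card = lam.card + n ∧ tailList lam ν = ρ := by
  have h0 := rowLen_eq_zero lam (le_refl (lam.colLen 0))
  obtain ⟨g, hg, rfl⟩ := exists_rowList_of_mem_strips _ _ h0 hρ
  rw [rowList_mem_strips_iff _ _ _ h0] at hρ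
  let r := (n + (rowList lam.rowLen (lam.colLen 0)).sum - (rowList g (lam.colLen 0)).sum).toNat
  let f : ℕ → ℕ := fun i => Nat.casesOn i r g
  have hg' : ∀ i, lam.rowLen (i + 1) ≤ g i ∧ g i ≤ lam.rowLen i := by
    intro i
    by_cases hi : i < lam.colLen 0
    · exact hρ i hi
    · rw [hg i (by omega), rowLen_eq_zero lam (i := i + 1) (by omega)]
      omega
  have hr' : lam.rowLen 0 ≤ r := by omega
  have hf : Antitone f := by
    refine antitone_nat_of_succ_le fun i => ?_
    rcases i with _ | i
    · exact (hg' 0).2.trans hr'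
    · exact (hg' (i + 1)).2.trans (hg' i).1
  obtain ⟨ν, hν⟩ := exists_youngDiagram f hf (lam.colLen 0 + 1) (hg _ le_rfl)
  have hI : Interlaces ν lam := by
    intro i
    rw [hν, hν]
    refine ⟨?_, (hg' i).2⟩
    rcases i with _ | i
    · exact hr'
    · exact (hg' i).1
  have ht : tailList lam ν = rowList g (lam.colLen 0) := by
    rw [tailList]
    simp only [hν]
    rfl
  refine ⟨ν, hI, ?_, ht⟩
  have h1 := card_le_of_interlaces hI
  have h2 := rowLen_zero_eq hI (n := ν.card - lam.card) (by omega)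
  have h3 : ν.rowLen 0 = r := hν 0
  rw [ht] at h2
  omega

/-- Pieri's formula for the first vertex operator. -/
theorem isFormalSum_Gamma1 (lam mu : YoungDiagram) :
    IsFormalSum (fun ν : {ν : YoungDiagram // Interlaces ν lam} => scale (P ν lam) (Q ν mu))
      (act Gamma1 (Q lam mu)) := by
  intro n
  let a := rowList lam.rowLen (lam.colLen 0)
  have h0 : lam.rowLen (lam.colLen 0) = 0 := rowLen_eq_zero lam le_rfl
  have hhead : a.headD 0 = lam.rowLen 0 := headD_rowList _ _ h0
  have ha : IsPart a := isPart_rowList _ (antitone_rowLen lam) _ h0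
  let D : Set {ν : YoungDiagram // Interlaces ν lam} := {ν | ν.1.card = lam.card + n}
  have hinj : Set.InjOn (fun ν : {ν : YoungDiagram // Interlaces ν lam} => tailList lam ν.1) D :=
    fun ν hν ν' hν' h => Subtype.ext (eq_of_tailList_eq ν.2 ν'.2 (hν.trans hν'.symm) h)
  have hD : D.Finite := Set.Finite.of_injOn (t := ↑(strips a))
    (fun ν _ => tailList_mem_strips ν.2) hinj (Finset.finite_toSet _)
  have hsupp : (Function.support fun ν : {ν : YoungDiagram // Interlaces ν lam} =>
      PowerSeries.coeff n (scale (P ν lam) (Q ν mu))) ⊆ D := by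
    intro ν hν
    by_contra h
    refine hν ?_
    simp only [coeff_scale_P ν.2]
    exact if_neg h
  refine ⟨hD.subset hsupp, ?_⟩
  rw [finsum_eq_sum_of_support_subset_of_finite _ hsupp hD, coeff_act_Gamma1,
    Q_eq_listQ lam mu le_rfl, q_xOp_listQ _ (vertexOp_vacuum mu) a ha]
  have hterm : ∀ ν ∈ hD.toFinset, PowerSeries.coeff n (scale (P ν.1 lam) (Q ν.1 mu)) =
      stripWeight a (tailList lam ν.1) (n + a.sum - (tailList lam ν.1).sum) •
        listQ (vacuum mu) ((n + a.sum - (tailList lam ν.1).sum) :: tailList lam ν.1) := by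
    intro ν hν
    have hcard : ν.1.card = lam.card + n := hD.mem_toFinset.1 hν
    rw [coeff_scale_P ν.2, if_pos hcard, ← rowLen_zero_eq ν.2 hcard,
      ← listPsi_eq_stripWeight ha (tailList_mem_strips ν.2)
        (by rw [hhead]; exact_mod_cast (ν.2 0).1),
      psi_eq_listPsi ν.2, Q_eq_listQ ν.1 mu (colLen_le_of_interlaces ν.2), rowList_succ]
    rfl
  rw [Finset.sum_congr rfl hterm, ← Finset.sum_image (g := fun ν => tailList lam ν.1)
    (f := fun ρ => stripWeight a ρ (n + a.sum - ρ.sum) •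
      listQ (vacuum mu) ((n + a.sum - ρ.sum) :: ρ))
    (fun ν hν ν' hν' h => hinj (hD.mem_toFinset.1 hν) (hD.mem_toFinset.1 hν') h)]
  symm
  refine Finset.sum_subset ?_ ?_
  · intro ρ hρ
    obtain ⟨ν, _, rfl⟩ := Finset.mem_image.1 hρ
    exact tailList_mem_strips ν.2
  -- A strip that comes from no `ν` forces a first part below `λ₁`, where the weight is zero by
  -- definition.
  · intro ρ hρ hρ'
    by_cases hr : (lam.rowLen 0 : ℤ) ≤ n + a.sum - ρ.sum
    · obtain ⟨ν, h1, h2, h3⟩ := exists_interlaces_of_mem_strips hρ hr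
      exact absurd (Finset.mem_image.2 ⟨⟨ν, h1⟩, hD.mem_toFinset.2 h2, h3⟩) hρ'
    · rw [stripWeight, if_pos (by rw [hhead]; omega), zero_smul]

end Pieri

/-! ### Exchange of `x` and `y` -/

section Symmetry

/-- The automorphism of `ℚ(t)[x, y]` that exchanges `xₙ` and `yₙ`. -/
def swapXY : A ≃ₐ[K] A := MvPolynomial.renameEquiv K (Equiv.sumComm ℕ+ ℕ+)

theorem swapXY_x (n : ℕ+) : swapXY (x n) = y n := by
  simp [swapXY, x, y]

theorem swapXY_y (n : ℕ+) : swapXY (y n) = x n := by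
  simp [swapXY, x, y]

theorem swapXY_q_x (n : ℤ) : swapXY (q x n) = q y n := by
  have := map_q (swapXY : A →ₐ[K] A) x n
  simpa only [AlgEquiv.coe_toAlgHom, swapXY_x] using this

theorem swapXY_q_y (n : ℤ) : swapXY (q y n) = q x n := by
  have := map_q (swapXY : A →ₐ[K] A) y n
  simpa only [AlgEquiv.coe_toAlgHom, swapXY_y] using this

theorem swapXY_qPair {l l' : ℕ} (α : Fin l → ℤ) (β : Fin l' → ℤ) :
    swapXY (qPair α β) = qPair β α := by
  simp only [qPair, map_mul, map_prod, swapXY_q_x, swapXY_q_y, mul_comm]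

/-- The exponents in the raising operator formula with the two index sequences exchanged. -/
def swapExponents (l l' : ℕ) :
    (Pairs l → ℕ) × (Pairs l' → ℕ) × (Fin l × Fin l' → ℕ) ≃
      (Pairs l' → ℕ) × (Pairs l → ℕ) × (Fin l' × Fin l → ℕ) where
  toFun e := (e.2.1, e.1, e.2.2 ∘ Prod.swap)
  invFun e := (e.2.1, e.1, e.2.2 ∘ Prod.swap)
  left_inv _ := rfl
  right_inv _ := rfl

theorem lowerLeft_swap {l l' : ℕ} (d : Fin l × Fin l' → ℕ) (β : Fin l' → ℤ) :
    lowerLeft (d ∘ Prod.swap) β = lowerRight d β := by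
  rw [lowerLeft, lowerRight]
  congr 1
  exact Fintype.sum_equiv (Equiv.prodComm _ _) _ _ fun _ => rfl

theorem lowerRight_swap {l l' : ℕ} (d : Fin l × Fin l' → ℕ) (α : Fin l → ℤ) :
    lowerRight (d ∘ Prod.swap) α = lowerLeft d α := by
  rw [lowerLeft, lowerRight]
  congr 1
  exact Fintype.sum_equiv (Equiv.prodComm _ _) _ _ fun _ => rfl

theorem swapXY_term {l l' : ℕ} (α : Fin l → ℤ) (β : Fin l' → ℤ)
    (e : (Pairs l → ℕ) × (Pairs l' → ℕ) × (Fin l × Fin l' → ℕ)) :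
    swapXY (term α β e) = term β α (swapExponents l l' e) := by
  simp only [term, swapExponents, Equiv.coe_fn_mk, map_smul, swapXY_qPair, lowerLeft_swap,
    lowerRight_swap]
  congr 1
  rw [mul_comm (∏ p, raiseCoeff (e.1 p))]
  congr 1
  exact Fintype.prod_equiv (Equiv.prodComm _ _) _ _ fun _ => rfl

theorem swapXY_Q (lam mu : YoungDiagram) : swapXY (Q lam mu) = Q mu lam := by
  rw [Q, map_finsum _ (term_support_finite _ _), finsum_congr (swapXY_term (rows lam) (rows mu))]
  exact finsum_comp_equiv (swapExponents (lam.colLen 0) (mu.colLen 0))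
    (f := term (rows mu) (rows lam))

theorem swapXY_xOp (n : ℕ+) (f : A) : swapXY (xOp n f) = yOp n (swapXY f) := by
  have h : MvPolynomial.pderiv (Sum.inl n) (swapXY f) =
      swapXY (MvPolynomial.pderiv (Sum.inr n) f) :=
    MvPolynomial.pderiv_rename (Equiv.sumComm ℕ+ ℕ+).injective (x := Sum.inr n) (p := f)
  simp only [xOp, yOp, LinearMap.sub_apply, LinearMap.mulLeft_apply, LinearMap.smul_apply,
    Derivation.coeFn_coe, map_sub, map_mul, map_smul, swapXY_x, h]

/-- Conjugation by `swapXY` is an algebra automorphism of the operators that sends `xOp` to `yOp`,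
so `map_q` applies. -/
theorem swapXY_q_xOp (n : ℤ) (f : A) : swapXY (q xOp n f) = q yOp n (swapXY f) := by
  let φ := swapXY.toLinearEquiv.conjAlgEquiv K
  have h : ∀ k, φ (xOp k) = yOp k := fun k => LinearMap.ext fun g => by
    rw [← swapXY.apply_symm_apply g, ← swapXY_xOp]
    simp [φ, LinearEquiv.conjAlgEquiv_apply]
  have h2 := map_q (φ : Module.End K A →ₐ[K] Module.End K A) xOp n
  simp only [AlgEquiv.coe_toAlgHom, h] at h2
  rw [← h2]
  simp [φ, LinearEquiv.conjAlgEquiv_apply]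

theorem isFormalSum_Gamma2 (lam mu : YoungDiagram) :
    IsFormalSum (fun ν : {ν : YoungDiagram // Interlaces ν mu} => scale (P ν mu) (Q lam ν))
      (act Gamma2 (Q lam mu)) := by
  intro n
  obtain ⟨h1, h2⟩ := isFormalSum_Gamma1 mu lam n
  have h3 : ∀ ν : {ν : YoungDiagram // Interlaces ν mu},
      PowerSeries.coeff n (scale (P ν mu) (Q lam ν)) =
        swapXY (PowerSeries.coeff n (scale (P ν mu) (Q ν lam))) := by
    intro ν
    rw [coeff_scale, coeff_scale, map_smul, swapXY_Q]
  have h4 : PowerSeries.coeff n (act Gamma2 (Q lam mu)) =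
      swapXY (PowerSeries.coeff n (act Gamma1 (Q mu lam))) := by
    rw [coeff_act_Gamma1, swapXY_q_xOp, swapXY_Q, act, PowerSeries.coeff_mk, q_natCast, Gamma2]
  simp only [h3, h4]
  refine ⟨h1.subset fun ν hν h => hν ?_, ?_⟩
  · simp only [h, map_zero]
  · rw [h2, map_finsum _ h1]

end Symmetry

end CoupledHL

end

theorem mainTheorem3 (lam mu : YoungDiagram) :
    CoupledHL.IsFormalSum
        (fun nu : {nu : YoungDiagram // CoupledHL.Interlaces nu lam} =>
          CoupledHL.scale (CoupledHL.P nu lam) (CoupledHL.Q nu mu))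
        (CoupledHL.act CoupledHL.Gamma1 (CoupledHL.Q lam mu)) ∧
      CoupledHL.IsFormalSum
        (fun nu : {nu : YoungDiagram // CoupledHL.Interlaces nu mu} =>
          CoupledHL.scale (CoupledHL.P nu mu) (CoupledHL.Q lam nu))
        (CoupledHL.act CoupledHL.Gamma2 (CoupledHL.Q lam mu)) :=
  ⟨CoupledHL.isFormalSum_Gamma1 lam mu, CoupledHL.isFormalSum_Gamma2 lam mu⟩
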